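/- Let $\mathsf k$ be a field of characteristic zero, let $n \ge 0$, and let $A_n(\mathsf k)$ be the $n$-th Weyl algebra, i.e. the unital associative $\mathsf k$-algebra generated by $x_1,\dots,x_n,\partial_1,\dots,\partial_n$ subject to $x_ix_j=x_jx_i$, $\partial_i\partial_j=\partial_j\partial_i$ and $\partial_i x_j-x_j\partial_i=\delta_{ij}$. It is an Ore domain; let $F_n(\mathsf k)$ be its skew field of fractions. A matrix $g\in GL_n(\mathsf k)$ acts on $A_n(\mathsf k)$ by the algebra automorphism $x_j\mapsto\sum_i g_{ij}x_i$, $\partial_j\mapsto\sum_i (g^{-1})_{ji}\partial_i$ (conjugation of differential operators on $\mathsf k[x_1,\dots,x_n]$ by the linear substitution $g$), and this action extends uniquely to $F_n(\mathsf k)$. An element of $GL_n(\mathsf k)$ is a pseudo-reflection if it has finite order and its fixed space in $\mathsf k^n$ is a hyperplane. Let $W\subset GL_n(\mathsf k)$ be a finite group generated by pseudo-reflections. Then the noncommutative Noether problem has a positive solution for $W$: the skew field of invariants $F_n(\mathsf k)^W$ is isomorphic to $F_n(\mathsf k)$ as a $\mathsf k$-algebra. -/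

import Mathlib

open scoped nonZeroDivisors

/-- The defining relations of the `n`-th Weyl algebra, on the free algebra generated by
`x_1, …, x_n` (`Sum.inl`) and `∂_1, …, ∂_n` (`Sum.inr`). -/
inductive WeylRel (k : Type*) [Field k] (n : ℕ) :
    FreeAlgebra k (Fin n ⊕ Fin n) → FreeAlgebra k (Fin n ⊕ Fin n) → Prop
  | x_comm (i j : Fin n) : WeylRel k n
      (FreeAlgebra.ι k (Sum.inl i) * FreeAlgebra.ι k (Sum.inl j))
      (FreeAlgebra.ι k (Sum.inl j) * FreeAlgebra.ι k (Sum.inl i))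
  | d_comm (i j : Fin n) : WeylRel k n
      (FreeAlgebra.ι k (Sum.inr i) * FreeAlgebra.ι k (Sum.inr j))
      (FreeAlgebra.ι k (Sum.inr j) * FreeAlgebra.ι k (Sum.inr i))
  | d_x (i j : Fin n) : WeylRel k n
      (FreeAlgebra.ι k (Sum.inr i) * FreeAlgebra.ι k (Sum.inl j)
        - FreeAlgebra.ι k (Sum.inl j) * FreeAlgebra.ι k (Sum.inr i))
      (if i = j then 1 else 0)

/-- The `n`-th Weyl algebra `A_n(k)`. -/
def WeylAlgebra (k : Type*) [Field k] (n : ℕ) : Type _ := RingQuot (WeylRel k n)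

namespace WeylAlgebra

variable {k : Type*} [Field k] {n : ℕ}

noncomputable instance : Ring (WeylAlgebra k n) := inferInstanceAs (Ring (RingQuot (WeylRel k n)))

noncomputable instance : Algebra k (WeylAlgebra k n) :=
  inferInstanceAs (Algebra k (RingQuot (WeylRel k n)))

/-- The quotient map from the free algebra. -/
noncomputable def mk (k : Type*) [Field k] (n : ℕ) :
    FreeAlgebra k (Fin n ⊕ Fin n) →ₐ[k] WeylAlgebra k n :=
  RingQuot.mkAlgHom k (WeylRel k n)

/-- The generator `x_i`. -/
noncomputable def x (k : Type*) [Field k] {n : ℕ} (i : Fin n) : WeylAlgebra k n :=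
  mk k n (FreeAlgebra.ι k (Sum.inl i))

/-- The generator `∂_i`. -/
noncomputable def d (k : Type*) [Field k] {n : ℕ} (i : Fin n) : WeylAlgebra k n :=
  mk k n (FreeAlgebra.ι k (Sum.inr i))

theorem x_comm (i j : Fin n) : x k i * x k j = x k j * x k i := by
  have := RingQuot.mkAlgHom_rel k (WeylRel.x_comm (k := k) i j)
  rw [map_mul, map_mul] at this
  exact this

theorem d_comm (i j : Fin n) : d k i * d k j = d k j * d k i := by
  have := RingQuot.mkAlgHom_rel k (WeylRel.d_comm (k := k) i j)
  rw [map_mul, map_mul] at this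
  exact this

theorem d_x (i j : Fin n) : d k i * x k j - x k j * d k i = if i = j then 1 else 0 := by
  have := RingQuot.mkAlgHom_rel k (WeylRel.d_x (k := k) i j)
  rw [map_sub, map_mul, map_mul] at this
  refine this.trans ?_
  split_ifs <;> simp <;> rfl

theorem lift_rel {B : Type*} [Ring B] [Algebra k B] (X D : Fin n → B)
    (hX : ∀ i j, X i * X j = X j * X i) (hD : ∀ i j, D i * D j = D j * D i)
    (hDX : ∀ i j, D i * X j - X j * D i = if i = j then 1 else 0)
    ⦃a b : FreeAlgebra k (Fin n ⊕ Fin n)⦄ (h : WeylRel k n a b) :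
    FreeAlgebra.lift k (Sum.elim X D) a = FreeAlgebra.lift k (Sum.elim X D) b := by
  cases h with
  | x_comm i j => simpa using hX i j
  | d_comm i j => simpa using hD i j
  | d_x i j =>
    have := hDX i j
    split_ifs at this ⊢ <;> simpa using this

/-- The universal property of the Weyl algebra. -/
noncomputable def lift {B : Type*} [Ring B] [Algebra k B] (X D : Fin n → B)
    (hX : ∀ i j, X i * X j = X j * X i) (hD : ∀ i j, D i * D j = D j * D i)
    (hDX : ∀ i j, D i * X j - X j * D i = if i = j then 1 else 0) :
    WeylAlgebra k n →ₐ[k] B :=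
  RingQuot.liftAlgHom k ⟨FreeAlgebra.lift k (Sum.elim X D), lift_rel X D hX hD hDX⟩

section lift

variable {B : Type*} [Ring B] [Algebra k B] (X D : Fin n → B)
    (hX : ∀ i j, X i * X j = X j * X i) (hD : ∀ i j, D i * D j = D j * D i)
    (hDX : ∀ i j, D i * X j - X j * D i = if i = j then 1 else 0)

@[simp] theorem lift_x (i : Fin n) : lift (k := k) X D hX hD hDX (x k i) = X i := by
  have := RingQuot.liftAlgHom_mkAlgHom_apply k (s := WeylRel k n)
    (FreeAlgebra.lift k (Sum.elim X D)) (lift_rel X D hX hD hDX)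
    (FreeAlgebra.ι k (Sum.inl i))
  rw [FreeAlgebra.lift_ι_apply] at this
  exact this

@[simp] theorem lift_d (i : Fin n) : lift (k := k) X D hX hD hDX (d k i) = D i := by
  have := RingQuot.liftAlgHom_mkAlgHom_apply k (s := WeylRel k n)
    (FreeAlgebra.lift k (Sum.elim X D)) (lift_rel X D hX hD hDX)
    (FreeAlgebra.ι k (Sum.inr i))
  rw [FreeAlgebra.lift_ι_apply] at this
  exact this

end lift

theorem algHom_ext {B : Type*} [Ring B] [Algebra k B] {f g : WeylAlgebra k n →ₐ[k] B}
    (hx : ∀ i, f (x k i) = g (x k i)) (hd : ∀ i, f (d k i) = g (d k i)) : f = g := by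
  refine RingQuot.ringQuot_ext' k (s := WeylRel k n) f g ?_
  refine FreeAlgebra.hom_ext ?_
  funext i
  cases i with
  | inl i => exact hx i
  | inr i => exact hd i

/-- Induction on left multiplication by generators. -/
theorem induction_left {p : WeylAlgebra k n → Prop} (one : p 1)
    (add : ∀ a b, p a → p b → p (a + b)) (smul : ∀ (c : k) a, p a → p (c • a))
    (x_mul : ∀ i a, p a → p (x k i * a)) (d_mul : ∀ i a, p a → p (d k i * a))
    (a : WeylAlgebra k n) : p a := by
  have key : ∀ w : FreeAlgebra k (Fin n ⊕ Fin n), ∀ b, p b → p (mk k n w * b) := by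
    intro w
    induction w using FreeAlgebra.induction with
    | grade0 r =>
      intro b hb
      rw [AlgHom.commutes, ← Algebra.smul_def]
      exact smul r b hb
    | grade1 i =>
      intro b hb
      cases i with
      | inl i => exact x_mul i b hb
      | inr i => exact d_mul i b hb
    | mul u v hu hv =>
      intro b hb
      rw [map_mul, mul_assoc]
      exact hu _ (hv _ hb)
    | add u v hu hv =>
      intro b hb
      rw [map_add, add_mul]
      exact add _ _ (hu _ hb) (hv _ hb)
  obtain ⟨w, rfl⟩ := RingQuot.mkAlgHom_surjective k (WeylRel k n) a
  have := key w 1 one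
  rw [mul_one] at this
  exact this

/-! ### The Weyl algebra is a domain

The algebra acts on polynomials in commuting variables `x_i`, `ξ_i` by `x_i ↦ x_i` and
`∂_i ↦ ξ_i + ∂/∂x_i`; the full symbol of `a` is `a · 1`. -/

/-- Polynomials in `x_1, …, x_n, ξ_1, …, ξ_n`. -/
abbrev Symb (k : Type*) [Field k] (n : ℕ) := MvPolynomial (Fin n ⊕ Fin n) k

open MvPolynomial in
theorem pderiv_comm' {σ : Type*} (i j : σ) (p : MvPolynomial σ k) :
    pderiv i (pderiv j p) = pderiv j (pderiv i p) := by
  classical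
  have h : ⁅(pderiv i : Derivation k (MvPolynomial σ k) (MvPolynomial σ k)),
      (pderiv j : Derivation k (MvPolynomial σ k) (MvPolynomial σ k))⁆ = 0 := by
    apply MvPolynomial.derivation_ext
    intro l
    simp [Derivation.commutator_apply, pderiv_X, Pi.single_apply, apply_ite]
  have := congrArg (fun D => D p) h
  simpa [Derivation.commutator_apply, sub_eq_zero] using this

/-- The action on symbols. -/
noncomputable def act (k : Type*) [Field k] (n : ℕ) :
    WeylAlgebra k n →ₐ[k] Module.End k (Symb k n) :=
  lift (fun i => LinearMap.mulLeft k (MvPolynomial.X (Sum.inl i)))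
    (fun i => LinearMap.mulLeft k (MvPolynomial.X (Sum.inr i)) +
      (MvPolynomial.pderiv (Sum.inl i)).toLinearMap)
    (by
      intro i j
      refine LinearMap.ext fun p => ?_
      simp only [Module.End.mul_apply, LinearMap.mulLeft_apply]
      ring)
    (by
      intro i j
      refine LinearMap.ext fun p => ?_
      simp [mul_add, pderiv_comm' (Sum.inl i : Fin n ⊕ Fin n) (Sum.inl j) p,
        Derivation.leibniz, MvPolynomial.pderiv_X]
      ring)
    (by
      intro i j
      refine LinearMap.ext fun p => ?_
      simp only [LinearMap.sub_apply, Module.End.mul_apply, LinearMap.add_apply,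
        LinearMap.mulLeft_apply, Derivation.coeFn_coe, Derivation.leibniz, smul_eq_mul,
        MvPolynomial.pderiv_X, Pi.single_apply, Sum.inl.injEq]
      by_cases h : i = j
      · subst h; simp; ring
      · simp [h, Ne.symm h]; ring)

theorem act_x (i : Fin n) (p : Symb k n) :
    act k n (x k i) p = MvPolynomial.X (Sum.inl i) * p := by
  simp [act]

theorem act_d (i : Fin n) (p : Symb k n) :
    act k n (d k i) p =
      MvPolynomial.X (Sum.inr i) * p + MvPolynomial.pderiv (Sum.inl i) p := by
  simp [act]

/-- The full symbol. -/
noncomputable def symb (k : Type*) [Field k] (n : ℕ) : WeylAlgebra k n →ₗ[k] Symb k n :=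
  (LinearMap.applyₗ (1 : Symb k n)).comp (act k n).toLinearMap

theorem symb_apply (a : WeylAlgebra k n) : symb k n a = act k n a 1 := rfl

theorem symb_mul (a b : WeylAlgebra k n) : symb k n (a * b) = act k n a (symb k n b) := by
  simp [symb_apply]

/-- Evaluation of a polynomial at a commuting family. -/
noncomputable def commEval {B : Type*} [Ring B] [Algebra k B] (f : Fin n → B)
    (hf : ∀ i j, f i * f j = f j * f i) : MvPolynomial (Fin n) k →ₐ[k] B :=
  haveI : IsMulCommutative (Algebra.adjoin k (Set.range f)) :=
    Algebra.isMulCommutative_adjoin k (by rintro _ ⟨i, rfl⟩ _ ⟨j, rfl⟩; exact hf i j)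
  letI : CommRing (Algebra.adjoin k (Set.range f)) :=
    { (inferInstance : Ring (Algebra.adjoin k (Set.range f))) with
      mul_comm := mul_comm' }
  (Algebra.adjoin k (Set.range f)).val.comp
    (MvPolynomial.aeval (S₁ := Algebra.adjoin k (Set.range f))
      fun i => ⟨f i, Algebra.subset_adjoin ⟨i, rfl⟩⟩)

@[simp] theorem commEval_X {B : Type*} [Ring B] [Algebra k B] (f : Fin n → B)
    (hf : ∀ i j, f i * f j = f j * f i) (i : Fin n) :
    commEval (k := k) f hf (MvPolynomial.X i) = f i := by
  simp [commEval]

/-- Polynomials in the `x_i`. -/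
noncomputable abbrev xPoly (k : Type*) [Field k] (n : ℕ) :
    MvPolynomial (Fin n) k →ₐ[k] WeylAlgebra k n := commEval (x k) x_comm

/-- Polynomials in the `∂_i`. -/
noncomputable abbrev dPoly (k : Type*) [Field k] (n : ℕ) :
    MvPolynomial (Fin n) k →ₐ[k] WeylAlgebra k n := commEval (d k) d_comm

theorem d_mul_xPoly (i : Fin n) (p : MvPolynomial (Fin n) k) :
    d k i * xPoly k n p = xPoly k n p * d k i + xPoly k n (MvPolynomial.pderiv i p) := by
  classical
  induction p using MvPolynomial.induction_on with
  | C c =>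
    have : (MvPolynomial.C c : MvPolynomial (Fin n) k) = algebraMap _ _ c := rfl
    rw [this, AlgHom.commutes, ← Algebra.commutes, Derivation.map_algebraMap, map_zero, add_zero]
  | add p q hp hq => simp only [map_add, mul_add, add_mul, hp, hq]; abel
  | mul_X p j hp =>
    have hc : d k i * x k j = x k j * d k i + if i = j then 1 else 0 := by
      rw [← d_x]; abel
    rw [map_mul, ← mul_assoc, hp, add_mul, mul_assoc, commEval_X, hc, Derivation.leibniz,
      map_add, smul_eq_mul, smul_eq_mul, map_mul, MvPolynomial.pderiv_X, mul_comm
      (MvPolynomial.X j), map_mul, commEval_X]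
    by_cases h : i = j
    · subst h; simp [mul_add, mul_assoc]; abel
    · simp [h, mul_assoc, Ne.symm h]

open Finsupp in
/-- Normal ordering: the linear map with `x^α ξ^β ↦ x^α ∂^β`. -/
noncomputable def normal (k : Type*) [Field k] (n : ℕ) : Symb k n →ₗ[k] WeylAlgebra k n :=
  (MvPolynomial.basisMonomials (Fin n ⊕ Fin n) k).constr k fun m =>
    xPoly k n (MvPolynomial.monomial (sumFinsuppAddEquivProdFinsupp m).1 1) *
      dPoly k n (MvPolynomial.monomial (sumFinsuppAddEquivProdFinsupp m).2 1)

open Finsupp in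
theorem normal_monomial (m : Fin n ⊕ Fin n →₀ ℕ) (c : k) :
    normal k n (MvPolynomial.monomial m c) =
      xPoly k n (MvPolynomial.monomial (sumFinsuppAddEquivProdFinsupp m).1 c) *
      dPoly k n (MvPolynomial.monomial (sumFinsuppAddEquivProdFinsupp m).2 1) := by
  have h : (MvPolynomial.monomial m c : Symb k n) = c • MvPolynomial.monomial m 1 := by
    simp [MvPolynomial.smul_monomial]
  have h2 := (MvPolynomial.basisMonomials (Fin n ⊕ Fin n) k).constr_basis k (fun m =>
    xPoly k n (MvPolynomial.monomial (sumFinsuppAddEquivProdFinsupp m).1 1) *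
      dPoly k n (MvPolynomial.monomial (sumFinsuppAddEquivProdFinsupp m).2 1)) m
  rw [MvPolynomial.coe_basisMonomials] at h2
  rw [h, map_smul, normal, h2, ← smul_mul_assoc, ← map_smul]
  simp [MvPolynomial.smul_monomial]

theorem normal_one : normal k n 1 = 1 := by
  have := normal_monomial (k := k) (0 : Fin n ⊕ Fin n →₀ ℕ) 1
  simpa using this

open Finsupp in
theorem split_single_inl_add (i : Fin n) (m : Fin n ⊕ Fin n →₀ ℕ) :
    sumFinsuppAddEquivProdFinsupp (single (Sum.inl i) 1 + m) =
      (single i 1 + (sumFinsuppAddEquivProdFinsupp m).1, (sumFinsuppAddEquivProdFinsupp m).2) := by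
  classical
  ext j <;> simp [single_apply]

open Finsupp in
theorem split_single_inr_add (i : Fin n) (m : Fin n ⊕ Fin n →₀ ℕ) :
    sumFinsuppAddEquivProdFinsupp (single (Sum.inr i) 1 + m) =
      ((sumFinsuppAddEquivProdFinsupp m).1, single i 1 + (sumFinsuppAddEquivProdFinsupp m).2) := by
  classical
  ext j <;> simp [single_apply]

open Finsupp in
theorem split_sub_single_inl (i : Fin n) (m : Fin n ⊕ Fin n →₀ ℕ) :
    sumFinsuppAddEquivProdFinsupp (m - single (Sum.inl i) 1) =
      ((sumFinsuppAddEquivProdFinsupp m).1 - single i 1, (sumFinsuppAddEquivProdFinsupp m).2) := by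
  classical
  ext j <;> simp [single_apply]

theorem X_mul_monomial {σ : Type*} (i : σ) (m : σ →₀ ℕ) (c : k) :
    MvPolynomial.X i * MvPolynomial.monomial m c =
      MvPolynomial.monomial (Finsupp.single i 1 + m) c := by
  rw [MvPolynomial.X, MvPolynomial.monomial_mul, one_mul]

theorem normal_x_mul (i : Fin n) (p : Symb k n) :
    normal k n (MvPolynomial.X (Sum.inl i) * p) = x k i * normal k n p := by
  induction p using MvPolynomial.induction_on' with
  | monomial m c =>
    rw [X_mul_monomial, normal_monomial, normal_monomial, split_single_inl_add,
      ← X_mul_monomial, map_mul, commEval_X, mul_assoc]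
  | add p q hp hq => rw [mul_add, map_add, map_add, mul_add, hp, hq]

theorem normal_d_mul (i : Fin n) (p : Symb k n) :
    normal k n (MvPolynomial.X (Sum.inr i) * p + MvPolynomial.pderiv (Sum.inl i) p) =
      d k i * normal k n p := by
  induction p using MvPolynomial.induction_on' with
  | monomial m c =>
    rw [X_mul_monomial, MvPolynomial.pderiv_monomial, map_add, normal_monomial, normal_monomial,
      normal_monomial, split_single_inr_add, split_sub_single_inl, ← X_mul_monomial, map_mul,
      commEval_X, ← mul_assoc, ← mul_assoc, d_mul_xPoly, MvPolynomial.pderiv_monomial, add_mul]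
    rfl
  | add p q hp hq =>
    have h : MvPolynomial.X (Sum.inr i) * (p + q) + MvPolynomial.pderiv (Sum.inl i) (p + q) =
        (MvPolynomial.X (Sum.inr i) * p + MvPolynomial.pderiv (Sum.inl i) p) +
        (MvPolynomial.X (Sum.inr i) * q + MvPolynomial.pderiv (Sum.inl i) q) := by
      rw [map_add, mul_add]
      abel
    rw [h, map_add (normal k n), hp, hq, map_add, mul_add]

theorem normal_act (a : WeylAlgebra k n) (p : Symb k n) :
    normal k n (act k n a p) = a * normal k n p := by
  induction a using induction_left with
  | one => simp
  | add a b ha hb => simp [ha, hb, add_mul]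
  | smul c a ha => simp [ha]
  | x_mul i a ha => rw [map_mul, Module.End.mul_apply, act_x, normal_x_mul, ha, mul_assoc]
  | d_mul i a ha => rw [map_mul, Module.End.mul_apply, act_d, normal_d_mul, ha, mul_assoc]

theorem normal_symb (a : WeylAlgebra k n) : normal k n (symb k n a) = a := by
  rw [symb_apply, normal_act, normal_one, mul_one]

theorem symb_injective : Function.Injective (symb k n) :=
  Function.LeftInverse.injective normal_symb

/-- Polynomials of total degree `< m`. -/
noncomputable def F (k : Type*) [Field k] (n m : ℕ) : Submodule k (Symb k n) :=
  MvPolynomial.restrictSupport k {s | s.degree < m}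

theorem monomial_mem_F {m : ℕ} {s : Fin n ⊕ Fin n →₀ ℕ} {c : k} :
    MvPolynomial.monomial s c ∈ F k n m ↔ s.degree < m ∨ c = 0 :=
  MvPolynomial.monomial_mem_restrictSupport k

theorem F_mono {a b : ℕ} (h : a ≤ b) : F k n a ≤ F k n b :=
  MvPolynomial.restrictSupport_mono k fun _ hs => lt_of_lt_of_le hs h

theorem F_zero {p : Symb k n} (hp : p ∈ F k n 0) : p = 0 := by
  rw [F, MvPolynomial.mem_restrictSupport_iff] at hp
  rw [← MvPolynomial.support_eq_empty, Finset.eq_empty_iff_forall_notMem]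
  intro s hs
  exact absurd (hp hs) (by simp)

theorem F_le {m : ℕ} {V : Submodule k (Symb k n)}
    (h : ∀ s : Fin n ⊕ Fin n →₀ ℕ, s.degree < m → MvPolynomial.monomial s 1 ∈ V) :
    F k n m ≤ V := by
  rw [F, MvPolynomial.restrictSupport_eq_span, Submodule.span_le]
  rintro _ ⟨s, hs, rfl⟩
  exact h s hs

theorem mem_F_succ {m : ℕ} {p : Symb k n} : p ∈ F k n (m + 1) ↔ p.totalDegree ≤ m := by
  rw [← MvPolynomial.mem_restrictTotalDegree, F, MvPolynomial.restrictTotalDegree]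
  simp [Finsupp.degree_eq_sum, Finsupp.sum_fintype]

theorem F_mul {a b : ℕ} {p q : Symb k n} (hp : p ∈ F k n a) (hq : q ∈ F k n b) :
    p * q ∈ F k n (a + b - 1) := by
  rcases a with _ | a
  · rw [F_zero hp, zero_mul]; exact zero_mem _
  rcases b with _ | b
  · rw [F_zero hq, mul_zero]; exact zero_mem _
  rw [show a + 1 + (b + 1) - 1 = a + b + 1 by omega]
  rw [mem_F_succ] at *
  exact (MvPolynomial.totalDegree_mul p q).trans (add_le_add hp hq)

theorem F_X_mul {a : ℕ} {p : Symb k n} (i : Fin n ⊕ Fin n) (hp : p ∈ F k n a) :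
    MvPolynomial.X i * p ∈ F k n (a + 1) := by
  have h : (MvPolynomial.X i : Symb k n) ∈ F k n 2 := by
    rw [mem_F_succ, MvPolynomial.totalDegree_X]
  exact F_mono (by omega) (F_mul h hp)

theorem F_pderiv {a : ℕ} {p : Symb k n} (i : Fin n ⊕ Fin n) (hp : p ∈ F k n a) :
    MvPolynomial.pderiv i p ∈ F k n (a - 1) := by
  refine F_le (V := (F k n (a - 1)).comap (MvPolynomial.pderiv i).toLinearMap) ?_ hp
  intro s hs
  rw [Submodule.mem_comap, Derivation.coeFn_coe, MvPolynomial.pderiv_monomial, monomial_mem_F]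
  by_cases h : s i = 0
  · right; simp [h]
  · left
    have h1 : Finsupp.single i 1 ≤ s := by
      rw [Finsupp.single_le_iff]; omega
    have h2 : (s - Finsupp.single i 1).degree + 1 = s.degree := by
      conv_rhs => rw [← tsub_add_cancel_of_le h1, map_add]
      simp
    omega

/-- `a` has degree at most `m` in the sense that its action is approximated, up to lower degree, by
multiplication with its symbol, of degree at most `m`. -/
def Good (m : ℕ) (a : WeylAlgebra k n) : Prop :=
  symb k n a ∈ F k n (m + 1) ∧
    ∀ (e : ℕ) (g : Symb k n), g ∈ F k n e → act k n a g - symb k n a * g ∈ F k n (m + e - 1)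

theorem Good.mono {m m' : ℕ} (h : m ≤ m') {a : WeylAlgebra k n} (ha : Good m a) : Good m' a :=
  ⟨F_mono (by omega) ha.1, fun e g hg => F_mono (by omega) (ha.2 e g hg)⟩

theorem Good.add {m : ℕ} {a b : WeylAlgebra k n} (ha : Good m a) (hb : Good m b) :
    Good m (a + b) := by
  refine ⟨by rw [map_add]; exact add_mem ha.1 hb.1, fun e g hg => ?_⟩
  have := add_mem (ha.2 e g hg) (hb.2 e g hg)
  convert this using 1
  simp only [map_add, LinearMap.add_apply]
  ring

theorem Good.smul {m : ℕ} {a : WeylAlgebra k n} (c : k) (ha : Good m a) : Good m (c • a) := by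
  refine ⟨by rw [map_smul]; exact Submodule.smul_mem _ _ ha.1, fun e g hg => ?_⟩
  have := Submodule.smul_mem _ c (ha.2 e g hg)
  convert this using 1
  simp [smul_sub]

theorem Good.zero {m : ℕ} : Good m (0 : WeylAlgebra k n) := by
  refine ⟨by simp, fun e g hg => by simp⟩

theorem good_one : Good 0 (1 : WeylAlgebra k n) := by
  refine ⟨?_, fun e g hg => ?_⟩
  · rw [mem_F_succ]; simp [symb_apply]
  · simp [symb_apply]

theorem Good.act_mem {m e : ℕ} {a : WeylAlgebra k n} (ha : Good m a) {g : Symb k n}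
    (hg : g ∈ F k n e) : act k n a g ∈ F k n (m + e) := by
  have h1 := F_mono (show m + e - 1 ≤ m + e by omega) (ha.2 e g hg)
  have h2 := F_mono (show m + 1 + e - 1 ≤ m + e by omega) (F_mul ha.1 hg)
  simpa using add_mem h1 h2

theorem Good.x_mul {m : ℕ} {a : WeylAlgebra k n} (i : Fin n) (ha : Good m a) :
    Good (m + 1) (x k i * a) := by
  have hs : symb k n (x k i * a) = MvPolynomial.X (Sum.inl i) * symb k n a := by
    rw [symb_mul, act_x]
  refine ⟨by rw [hs]; exact F_X_mul _ ha.1, fun e g hg => ?_⟩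
  rcases e with _ | e
  · rw [F_zero hg]; simp
  have h := F_X_mul (Sum.inl i) (ha.2 _ g hg)
  convert F_mono (show m + (e + 1) - 1 + 1 ≤ m + 1 + (e + 1) - 1 by omega) h using 1
  rw [hs, map_mul, Module.End.mul_apply, act_x]
  ring

theorem Good.d_mul {m : ℕ} {a : WeylAlgebra k n} (i : Fin n) (ha : Good m a) :
    Good (m + 1) (d k i * a) := by
  have hs : symb k n (d k i * a) = MvPolynomial.X (Sum.inr i) * symb k n a +
      MvPolynomial.pderiv (Sum.inl i) (symb k n a) := by
    rw [symb_mul, act_d]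
  have hd := F_pderiv (Sum.inl i) ha.1
  refine ⟨by rw [hs]; exact add_mem (F_X_mul _ ha.1) (F_mono (by omega) hd), fun e g hg => ?_⟩
  rcases e with _ | e
  · rw [F_zero hg]; simp
  have h1 := F_mono (show m + (e + 1) - 1 + 1 ≤ m + 1 + (e + 1) - 1 by omega)
    (F_X_mul (Sum.inr i) (ha.2 _ g hg))
  have h2 := F_mono (show m + (e + 1) - 1 ≤ m + 1 + (e + 1) - 1 by omega)
    (F_pderiv (Sum.inl i) (ha.act_mem hg))
  have h3 := F_mono (show m + 1 - 1 + (e + 1) - 1 ≤ m + 1 + (e + 1) - 1 by omega) (F_mul hd hg)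
  convert sub_mem (add_mem h1 h2) h3 using 1
  rw [hs, map_mul, Module.End.mul_apply, act_d]
  ring

theorem good_normal_monomial (m : ℕ) : ∀ s : Fin n ⊕ Fin n →₀ ℕ, s.degree ≤ m →
    ∀ c : k, Good m (normal k n (MvPolynomial.monomial s c)) := by
  induction m with
  | zero =>
    intro s hs c
    have h0 : s = 0 := by
      rw [← Finsupp.degree_eq_zero_iff]; omega
    have : (MvPolynomial.monomial s c : Symb k n) = c • 1 := by
      rw [h0, MvPolynomial.smul_eq_C_mul, mul_one, MvPolynomial.C_apply]
    rw [this, map_smul, normal_one]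
    exact good_one.smul c
  | succ m ih =>
    intro s hs c
    by_cases h0 : s = 0
    · exact (ih s (by simp [h0]) c).mono (Nat.le_succ m)
    obtain ⟨i, hi⟩ := Finsupp.ne_iff.mp h0
    have h1 : Finsupp.single i 1 ≤ s := by
      rw [Finsupp.single_le_iff]
      exact Nat.one_le_iff_ne_zero.mpr hi
    have h2 : Finsupp.single i 1 + (s - Finsupp.single i 1) = s := add_tsub_cancel_of_le h1
    have h3 : (s - Finsupp.single i 1).degree + 1 = s.degree := by
      conv_rhs => rw [← h2, map_add]
      simp [add_comm]
    have ih1 := ih (s - Finsupp.single i 1) (by omega) c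
    rw [← h2, ← X_mul_monomial]
    cases i with
    | inl i =>
      rw [normal_x_mul]
      exact ih1.x_mul i
    | inr i =>
      have h4 := normal_d_mul i (MvPolynomial.monomial (s - Finsupp.single (Sum.inr i) 1) c)
      rw [map_add, ← eq_sub_iff_add_eq] at h4
      rw [h4, sub_eq_add_neg, ← neg_one_smul k]
      refine (ih1.d_mul i).add (Good.smul _ ?_)
      rw [MvPolynomial.pderiv_monomial]
      refine (ih _ ?_ _).mono (Nat.le_succ m)
      have : (s - Finsupp.single (Sum.inr i) 1 - Finsupp.single (Sum.inl i) 1).degree ≤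
        (s - Finsupp.single (Sum.inr i) 1).degree := Finsupp.degree_mono tsub_le_self
      omega

theorem good_of_symb_mem {m : ℕ} {a : WeylAlgebra k n} (ha : symb k n a ∈ F k n (m + 1)) :
    Good m a := by
  rw [← normal_symb a]
  let V : Submodule k (Symb k n) :=
    { carrier := {p | Good m (normal k n p)}
      add_mem' := fun {p q} hp hq => by
        rw [Set.mem_ofPred_eq, map_add]; exact Good.add hp hq
      zero_mem' := by rw [Set.mem_ofPred_eq, map_zero]; exact Good.zero
      smul_mem' := fun c p hp => by
        rw [Set.mem_ofPred_eq, map_smul]; exact Good.smul c hp }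
  exact F_le (V := V) (fun s hs => good_normal_monomial m s (Nat.lt_succ_iff.mp hs) 1) ha

instance : NoZeroDivisors (WeylAlgebra k n) where
  eq_zero_or_eq_zero_of_mul_eq_zero := by
    intro a b hab
    by_contra! hne
    have ha : symb k n a ≠ 0 := fun h => hne.1 (symb_injective (by rw [h, map_zero]))
    have hb : symb k n b ≠ 0 := fun h => hne.2 (symb_injective (by rw [h, map_zero]))
    have hg := (good_of_symb_mem (mem_F_succ.mpr le_rfl : symb k n a ∈ _)).2 _ _
      (mem_F_succ.mpr le_rfl : symb k n b ∈ _)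
    rw [← symb_mul, hab, map_zero, zero_sub, neg_mem_iff] at hg
    have hdeg := MvPolynomial.totalDegree_mul_of_isDomain ha hb
    rcases h : (symb k n a).totalDegree + (symb k n b).totalDegree with _ | e
    · rw [show (symb k n a).totalDegree + ((symb k n b).totalDegree + 1) - 1 = 0 by omega] at hg
      exact mul_ne_zero ha hb (F_zero hg)
    · rw [show (symb k n a).totalDegree + ((symb k n b).totalDegree + 1) - 1 = e + 1 by omega,
        mem_F_succ] at hg
      omega

instance : Nontrivial (WeylAlgebra k n) :=
  ⟨⟨0, 1, fun h => by
    have := congrArg (symb k n) h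
    simp [symb_apply] at this⟩⟩

/-! ### The Ore condition, by dimension counting -/

instance (m : ℕ) : Module.Finite k (F k n m) := by
  rcases m with _ | m
  · have : F k n 0 = ⊥ := (Submodule.eq_bot_iff _).mpr fun _ => F_zero
    rw [this]; infer_instance
  · have : F k n (m + 1) = MvPolynomial.restrictTotalDegree _ k m := by
      ext p; rw [mem_F_succ, MvPolynomial.mem_restrictTotalDegree]
    rw [this]; infer_instance

theorem finrank_F_le (m : ℕ) : Module.finrank k (F k n m) ≤ m ^ (n + n) := by
  classical
  have hb := Module.finrank_eq_nat_card_basis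
    (MvPolynomial.basisRestrictSupport k {s : Fin n ⊕ Fin n →₀ ℕ | s.degree < m})
  rw [F, hb]
  let f : {s : Fin n ⊕ Fin n →₀ ℕ | s.degree < m} → (Fin n ⊕ Fin n → Fin m) :=
    fun s i => ⟨s.1 i, lt_of_le_of_lt (Finsupp.le_degree i s.1) s.2⟩
  have hf : Function.Injective f := by
    intro s t hst
    ext i
    exact congrArg Fin.val (congrFun hst i)
  refine (Nat.card_le_card_of_injective f hf).trans ?_
  simp

/-- Elements with symbol of total degree `< m`. -/
noncomputable def V (k : Type*) [Field k] (n m : ℕ) : Submodule k (WeylAlgebra k n) :=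
  (F k n m).comap (symb k n)

instance (m : ℕ) : Module.Finite k (V k n m) :=
  Module.Finite.of_injective
    ((symb k n).restrict (p := V k n m) (q := F k n m) fun _ h => h)
    (fun _ _ h => Subtype.ext (symb_injective (congrArg Subtype.val h)))

theorem finrank_V_le (m : ℕ) : Module.finrank k (V k n m) ≤ m ^ (n + n) :=
  (LinearMap.finrank_le_finrank_of_injective
    (f := (symb k n).restrict (p := V k n m) (q := F k n m) fun _ h => h)
    (fun _ _ h => Subtype.ext (symb_injective (congrArg Subtype.val h)))).trans (finrank_F_le m)

theorem V_mul {m e : ℕ} {a b : WeylAlgebra k n} (ha : a ∈ V k n m) (hb : b ∈ V k n e) :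
    a * b ∈ V k n (m + e) := by
  rcases m with _ | m
  · rw [show a = 0 from symb_injective (by rw [F_zero ha, map_zero]), zero_mul]
    exact zero_mem _
  · change symb k n (a * b) ∈ F k n _
    rw [symb_mul]
    exact F_mono (by omega) ((good_of_symb_mem ha).act_mem hb)

theorem exists_mem_V (a : WeylAlgebra k n) : ∃ m, a ∈ V k n m :=
  ⟨(symb k n a).totalDegree + 1, mem_F_succ.mpr le_rfl⟩

theorem V_mono {a b : ℕ} (h : a ≤ b) : V k n a ≤ V k n b := Submodule.comap_mono (F_mono h)

theorem ore (r s : WeylAlgebra k n) (hs : s ≠ 0) :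
    ∃ u v : WeylAlgebra k n, u ≠ 0 ∧ u * r = v * s := by
  by_contra! hcon
  obtain ⟨e1, he1⟩ := exists_mem_V r
  obtain ⟨e2, he2⟩ := exists_mem_V s
  set e := max e1 e2
  have her : r ∈ V k n e := V_mono (le_max_left _ _) he1
  have hes : s ∈ V k n e := V_mono (le_max_right _ _) he2
  have hstep (m : ℕ) : 2 * Module.finrank k (V k n m) ≤ Module.finrank k (V k n (m + e)) := by
    let T : (V k n m × V k n m) →ₗ[k] V k n (m + e) :=
      { toFun := fun p => ⟨p.1 * r - p.2 * s, sub_mem (V_mul p.1.2 her) (V_mul p.2.2 hes)⟩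
        map_add' := fun p q => by
          ext1
          simp only [Prod.fst_add, Prod.snd_add, Submodule.coe_add, add_mul]
          abel
        map_smul' := fun c p => by
          ext1
          simp [smul_sub] }
    have hT : Function.Injective T := by
      rw [← LinearMap.ker_eq_bot, LinearMap.ker_eq_bot']
      rintro ⟨u, v⟩ h
      have h' : (u : WeylAlgebra k n) * r = v * s := sub_eq_zero.mp (congrArg Subtype.val h)
      have hu : (u : WeylAlgebra k n) = 0 := by
        by_contra hu
        exact hcon u v hu h'
      rw [hu, zero_mul, eq_comm, mul_eq_zero, or_iff_left hs] at h'
      exact Prod.ext (Subtype.ext hu) (Subtype.ext h')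
    have := LinearMap.finrank_le_finrank_of_injective hT
    rw [Module.finrank_prod] at this
    omega
  have hone : 1 ≤ Module.finrank k (V k n 1) := by
    have h1 : (1 : WeylAlgebra k n) ∈ V k n 1 := good_one.1
    have : Nontrivial (V k n 1) :=
      ⟨⟨0, ⟨1, h1⟩, fun h => zero_ne_one (congrArg Subtype.val h)⟩⟩
    exact Module.finrank_pos
  have hpow (j : ℕ) : 2 ^ j ≤ Module.finrank k (V k n (1 + j * e)) := by
    induction j with
    | zero => simpa using hone
    | succ j ih =>
      have := hstep (1 + j * e)
      rw [show 1 + (j + 1) * e = 1 + j * e + e by ring, pow_succ]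
      omega
  have hgrow : ∃ j : ℕ, (1 + j * e) ^ (n + n) < 2 ^ j := by
    have h1 := tendsto_pow_const_div_const_pow_of_one_lt (n + n) (r := (2 : ℝ)) one_lt_two
    have h2 := h1.const_mul (((1 : ℝ) + e) ^ (n + n))
    rw [mul_zero] at h2
    have h3 := (h2.eventually (gt_mem_nhds one_pos)).and (Filter.eventually_ge_atTop 1)
    obtain ⟨j, hj, hj1⟩ := h3.exists
    refine ⟨j, ?_⟩
    have h4 : ((1 : ℝ) + j * e) ^ (n + n) ≤ (1 + e) ^ (n + n) * j ^ (n + n) := by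
      rw [← mul_pow]
      have : (1 : ℝ) ≤ j := by exact_mod_cast hj1
      gcongr
      linarith
    rw [← mul_div_assoc, div_lt_one (by positivity)] at hj
    exact_mod_cast h4.trans_lt hj
  obtain ⟨j, hj⟩ := hgrow
  exact absurd ((hpow j).trans (finrank_V_le _)) (not_le.mpr hj)

noncomputable instance : OreLocalization.OreSet (WeylAlgebra k n)⁰ :=
  Nonempty.some <| OreLocalization.nonempty_oreSet_iff_of_noZeroDivisors.mpr fun r s => by
    obtain ⟨u, v, hu, h⟩ := ore r s (nonZeroDivisors.coe_ne_zero s)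
    exact ⟨v, ⟨u, mem_nonZeroDivisors_of_ne_zero hu⟩, h⟩

end WeylAlgebra

/-- The Weyl field `F_n(k)`, the skew field of (left) fractions of `A_n(k)`. -/
abbrev WeylField (k : Type*) [Field k] (n : ℕ) : Type _ :=
  OreLocalization (WeylAlgebra k n)⁰ (WeylAlgebra k n)

namespace WeylAlgebra

variable {k : Type*} [Field k] {n : ℕ}

/-- The endomorphism of `A_n(k)` induced by `g`: the matrix `g` acts on the span of the `x_i`
(with basis the `x_i`), and contragrediently on the span of the `∂_i`. On differential operators of
`k[x_1, …, x_n]` this is the conjugation `D ↦ g ∘ D ∘ g⁻¹`. -/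
noncomputable def linearEnd (g : GL (Fin n) k) : WeylAlgebra k n →ₐ[k] WeylAlgebra k n :=
  lift (fun j => ∑ i, (g : Matrix (Fin n) (Fin n) k) i j • x k i)
    (fun j => ∑ i, ((g⁻¹ : GL (Fin n) k) : Matrix (Fin n) (Fin n) k) j i • d k i)
    (fun a b => by
      simp only [Finset.sum_mul_sum, smul_mul_smul_comm]
      rw [Finset.sum_comm]
      refine Finset.sum_congr rfl fun i _ => Finset.sum_congr rfl fun j _ => ?_
      rw [x_comm, mul_comm])
    (fun a b => by
      simp only [Finset.sum_mul_sum, smul_mul_smul_comm]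
      rw [Finset.sum_comm]
      refine Finset.sum_congr rfl fun i _ => Finset.sum_congr rfl fun j _ => ?_
      rw [d_comm, mul_comm])
    (fun a b => by
      have h : ((g⁻¹ : GL (Fin n) k) : Matrix (Fin n) (Fin n) k) * g = 1 := by
        rw [← Units.val_mul, inv_mul_cancel, Units.val_one]
      have h' := congrFun (congrFun h a) b
      rw [Matrix.mul_apply, Matrix.one_apply] at h'
      simp only [Finset.sum_mul_sum, smul_mul_smul_comm]
      rw [Finset.sum_comm (s := Finset.univ) (t := Finset.univ) (f := fun i j =>
        ((g : Matrix (Fin n) (Fin n) k) i b *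
          ((g⁻¹ : GL (Fin n) k) : Matrix (Fin n) (Fin n) k) a j) • (x k i * d k j)),
        ← Finset.sum_sub_distrib]
      simp_rw [← Finset.sum_sub_distrib]
      have h2 (i j : Fin n) :
          (((g⁻¹ : GL (Fin n) k) : Matrix (Fin n) (Fin n) k) a i *
              (g : Matrix (Fin n) (Fin n) k) j b) • (d k i * x k j) -
            ((g : Matrix (Fin n) (Fin n) k) j b *
              ((g⁻¹ : GL (Fin n) k) : Matrix (Fin n) (Fin n) k) a i) • (x k j * d k i) =
          if i = j then algebraMap k (WeylAlgebra k n)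
            (((g⁻¹ : GL (Fin n) k) : Matrix (Fin n) (Fin n) k) a i *
              (g : Matrix (Fin n) (Fin n) k) j b) else 0 := by
        rw [mul_comm ((g : Matrix (Fin n) (Fin n) k) j b), ← smul_sub, d_x]
        split_ifs
        · rw [Algebra.algebraMap_eq_smul_one]
        · rw [smul_zero]
      simp_rw [h2]
      simp only [Finset.sum_ite_eq, Finset.mem_univ, if_true]
      rw [← map_sum, h']
      split_ifs <;> simp)

@[simp] theorem linearEnd_x (g : GL (Fin n) k) (j : Fin n) :
    linearEnd g (x k j) = ∑ i, (g : Matrix (Fin n) (Fin n) k) i j • x k i := by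
  simp [linearEnd]

@[simp] theorem linearEnd_d (g : GL (Fin n) k) (j : Fin n) :
    linearEnd g (d k j) =
      ∑ i, ((g⁻¹ : GL (Fin n) k) : Matrix (Fin n) (Fin n) k) j i • d k i := by
  rw [linearEnd, lift_d]

theorem linearEnd_one : linearEnd (1 : GL (Fin n) k) = AlgHom.id k _ := by
  refine algHom_ext (fun j => ?_) (fun j => ?_)
  · simp [Matrix.one_apply]
  · simp [Matrix.one_apply]

theorem linearEnd_mul (g h : GL (Fin n) k) :
    linearEnd (g * h) = (linearEnd g).comp (linearEnd h) := by
  refine algHom_ext (fun j => ?_) (fun j => ?_)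
  · simp only [linearEnd_x, AlgHom.comp_apply, map_sum, map_smul, Units.val_mul,
      Matrix.mul_apply, Finset.smul_sum, Finset.sum_smul, smul_smul]
    rw [Finset.sum_comm]
    refine Finset.sum_congr rfl fun i _ => Finset.sum_congr rfl fun l _ => ?_
    rw [mul_comm]
  · simp only [linearEnd_d, AlgHom.comp_apply, map_sum, map_smul, mul_inv_rev, Units.val_mul,
      Matrix.mul_apply, Finset.smul_sum, Finset.sum_smul, smul_smul]
    rw [Finset.sum_comm]

/-- The linear action of `GL_n(k)` on `A_n(k)` by algebra automorphisms. -/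
noncomputable def linearAction (k : Type*) [Field k] (n : ℕ) :
    GL (Fin n) k →* (WeylAlgebra k n ≃ₐ[k] WeylAlgebra k n) where
  toFun g := AlgEquiv.ofAlgHom (linearEnd g) (linearEnd g⁻¹)
    (by rw [← linearEnd_mul, mul_inv_cancel, linearEnd_one])
    (by rw [← linearEnd_mul, inv_mul_cancel, linearEnd_one])
  map_one' := by
    ext a
    exact congrArg (fun f => f a) (linearEnd_one (k := k) (n := n))
  map_mul' g h := by
    ext a
    exact congrArg (fun f => f a) (linearEnd_mul g h)

end WeylAlgebra

namespace WeylField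

variable {k : Type*} [Field k] {n : ℕ}

/-- The endomorphism of `F_n(k)` extending an automorphism of `A_n(k)`. -/
noncomputable def extend (e : WeylAlgebra k n ≃ₐ[k] WeylAlgebra k n) :
    WeylField k n →ₐ[k] WeylField k n :=
  { OreLocalization.universalHom (S := (WeylAlgebra k n)⁰)
      (OreLocalization.numeratorRingHom.comp (e : WeylAlgebra k n →+* WeylAlgebra k n))
      { toFun := fun s => OreLocalization.numeratorUnit
          ⟨e s, mem_nonZeroDivisors_of_ne_zero
            ((map_ne_zero_iff e e.injective).mpr (nonZeroDivisors.coe_ne_zero s))⟩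
        map_one' := Units.ext (by
          change OreLocalization.numeratorHom (e 1) = 1
          rw [map_one, map_one])
        map_mul' := fun s t => Units.ext (by
          change OreLocalization.numeratorHom (e (s * t)) =
            OreLocalization.numeratorHom (e s) * OreLocalization.numeratorHom (e t)
          rw [map_mul, map_mul]) }
      (fun _ => rfl) with
    commutes' := fun c => by
      refine (OreLocalization.universalHom_commutes _ _ _).trans ?_
      exact congrArg OreLocalization.numeratorHom (e.commutes c) }

theorem extend_numerator (e : WeylAlgebra k n ≃ₐ[k] WeylAlgebra k n) (a : WeylAlgebra k n) :
    extend e (OreLocalization.numeratorHom a) = OreLocalization.numeratorHom (e a) :=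
  OreLocalization.universalHom_commutes _ _ _

theorem algHom_ext {f g : WeylField k n →ₐ[k] WeylField k n}
    (h : ∀ a : WeylAlgebra k n, f (OreLocalization.numeratorHom a) =
      g (OreLocalization.numeratorHom a)) : f = g := by
  ext z
  induction z using OreLocalization.ind with | _ r s
  have hs : OreLocalization.numeratorHom (s : WeylAlgebra k n) * (r /ₒ s) =
      (OreLocalization.numeratorHom r : WeylField k n) := by
    simp [OreLocalization.mul_cancel]
  have hs0 : g (OreLocalization.numeratorHom (s : WeylAlgebra k n)) ≠ 0 :=
    ((OreLocalization.numerator_isUnit s).map g).ne_zero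
  have h1 := h r
  rw [← hs, map_mul, map_mul, h s] at h1
  exact mul_left_cancel₀ hs0 h1

theorem extend_one : extend (1 : WeylAlgebra k n ≃ₐ[k] WeylAlgebra k n) = AlgHom.id k _ :=
  algHom_ext fun a => extend_numerator _ a

theorem extend_mul (e f : WeylAlgebra k n ≃ₐ[k] WeylAlgebra k n) :
    extend (e * f) = (extend e).comp (extend f) :=
  algHom_ext fun a => by
    rw [AlgHom.comp_apply, extend_numerator, extend_numerator, extend_numerator]
    rfl

/-- The unique extension of automorphisms of `A_n(k)` to automorphisms of `F_n(k)`. -/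
noncomputable def extendHom (k : Type*) [Field k] (n : ℕ) :
    (WeylAlgebra k n ≃ₐ[k] WeylAlgebra k n) →* (WeylField k n ≃ₐ[k] WeylField k n) where
  toFun e := AlgEquiv.ofAlgHom (extend e) (extend e⁻¹)
    (by rw [← extend_mul, mul_inv_cancel, extend_one])
    (by rw [← extend_mul, inv_mul_cancel, extend_one])
  map_one' := by
    ext a
    exact congrArg (fun f => f a) (extend_one (k := k) (n := n))
  map_mul' e f := by
    ext a
    exact congrArg (fun h => h a) (extend_mul e f)

/-- The linear action of `GL_n(k)` on `F_n(k)`. -/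
noncomputable def linearAction (k : Type*) [Field k] (n : ℕ) :
    GL (Fin n) k →* (WeylField k n ≃ₐ[k] WeylField k n) :=
  (extendHom k n).comp (WeylAlgebra.linearAction k n)

/-- The invariants `F_n(k)^W`. -/
noncomputable def invariants (W : Subgroup (GL (Fin n) k)) : Subalgebra k (WeylField k n) where
  carrier := {f | ∀ g ∈ W, linearAction k n g f = f}
  mul_mem' := fun {a b} ha hb g hg => by rw [map_mul, ha g hg, hb g hg]
  add_mem' := fun {a b} ha hb g hg => by rw [map_add, ha g hg, hb g hg]
  algebraMap_mem' := fun c g _ => AlgEquiv.commutes _ c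

end WeylField

/-- A pseudo-reflection: an invertible linear map of finite order whose fixed space is a
hyperplane. -/
def IsPseudoReflection {k : Type*} [Field k] {n : ℕ} (g : GL (Fin n) k) : Prop :=
  IsOfFinOrder g ∧
    Module.finrank k
      (LinearMap.ker (Matrix.toLin' (g : Matrix (Fin n) (Fin n) k) - LinearMap.id)) + 1 = n

/-- A pseudo-reflection group: a finite group of matrices generated by pseudo-reflections. -/
def IsPseudoReflectionGroup {k : Type*} [Field k] {n : ℕ} (W : Subgroup (GL (Fin n) k)) : Prop :=
  Finite W ∧ Subgroup.closure {g | g ∈ W ∧ IsPseudoReflection g} = W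

/-!
The proof combines the Chevalley-Shephard-Todd theorem with the fact that vector fields lift
uniquely along a generically étale map. Write `K = k(x_1, …, x_n)`.

*Invariant theory.* If `s` is a reflection with linear form `l`, then `l` divides `s p - p` for all
polynomials `p`. By induction on the degree, a syzygy between invariants therefore differs from its
average over the group by a combination of invariant syzygies, so that the invariant syzygies
generate all syzygies (`IsReflectionAction.mem_invSyz`). Let `f_1, …, f_m` be a minimal family of
homogeneous generators of the ideal spanned by the invariants without constant term. They generate
the algebra of invariants (`IsBasicInvariants.mem_adjoin`). Their gradients are linearly independent
(`IsBasicInvariants.linearIndependent_pderiv`): a relation can be averaged to an invariant one, and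
Euler's formula together with the description of the syzygies shows that the coefficients of such a
relation form a vector killed by a square matrix with nonzero determinant. So `m ≤ n`. On the other hand,
`K` is separable over `K^W = k(f)`, so a derivation of `K` that vanishes on the `f_i` is zero; this
gives `n ≤ m` and derivations `D_1, …, D_n` of `K` with `D_i f_j = δ_ij`
(`IsReflectionAction.exists_coordinates`).

*The Weyl field.* Both `K` and its derivations embed into `F_n(k)`, compatibly with commutators
(`WeylField.ofDerivation_mul_ofRat`, `WeylField.ofDerivation_lie`) and with the linear action. The
`D_i` commute and are `W`-invariant, as they are determined by their values on the `f_j`. Hence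
`x_i ↦ f_i`, `∂_i ↦ D_i` defines a homomorphism from `A_n(k)` to the invariants. It is injective
because `A_n(k)` is simple (`WeylAlgebra.algHom_injective`), so it extends to `F_n(k)`. Its image
`L` is a skew field containing `K^W`, over which the span of `K` is finite-dimensional and closed
under right multiplication by `A_n(k)`, hence by inverses as well; so `K` spans `F_n(k)` over `L`
(`WeylField.span_range_ofRat_eq_top`). Averaging over `W` shows that all invariants lie in `L`
(`WeylField.mem_of_mem_invariants`).
-/

/-! ### Reflection actions on polynomials -/

namespace MvPolynomial

section Graded

variable {k : Type*} [CommSemiring k] {σ : Type*}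

attribute [local instance] MvPolynomial.gradedAlgebra

theorem homogeneousComponent_add_mul {d : ℕ} {f : MvPolynomial σ k} (hf : f.IsHomogeneous d)
    (e : ℕ) (p : MvPolynomial σ k) :
    homogeneousComponent (e + d) (p * f) = homogeneousComponent e p * f := by
  have := DirectSum.coe_decompose_mul_add_of_right_mem (homogeneousSubmodule σ k) (i := e) (a := p)
    (b := f) ((mem_homogeneousSubmodule d f).mpr hf)
  simp only [← decomposition.decompose'_apply]
  exact this

theorem homogeneousComponent_mul_of_lt {d : ℕ} {f : MvPolynomial σ k} (hf : f.IsHomogeneous d)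
    {e : ℕ} (he : e < d) (p : MvPolynomial σ k) :
    homogeneousComponent e (p * f) = 0 := by
  have := DirectSum.coe_decompose_mul_of_right_mem_of_not_le (homogeneousSubmodule σ k) (n := e)
    (a := p) (b := f) ((mem_homogeneousSubmodule d f).mpr hf) (not_le.mpr he)
  simp only [← decomposition.decompose'_apply]
  exact this

end Graded

end MvPolynomial

section Syzygies

open MvPolynomial

variable {k : Type*} [Field k] {n : ℕ} {G : Type*} [Group G]
  [MulSemiringAction G (MvPolynomial (Fin n) k)]

variable (k n G) in
/-- A degree-preserving action of a group on `k[x_1, …, x_n]` by ring automorphisms, such that the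
group is generated by elements `s` for which some nonzero linear form divides all `s p - p`. -/
structure IsReflectionAction : Prop where
  homog : ∀ (g : G) (p : MvPolynomial (Fin n) k) (d : ℕ), p.IsHomogeneous d →
    (g • p).IsHomogeneous d
  closure_eq_top : Subgroup.closure {s : G | ∃ l : MvPolynomial (Fin n) k,
    l ≠ 0 ∧ l.IsHomogeneous 1 ∧ ∀ p, l ∣ s • p - p} = ⊤

namespace IsReflectionAction

theorem totalDegree_smul_le (h : IsReflectionAction k n G) (g : G)
    (p : MvPolynomial (Fin n) k) : (g • p).totalDegree ≤ p.totalDegree := by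
  conv_lhs => rw [← sum_homogeneousComponent p, Finset.smul_sum]
  refine totalDegree_finsetSum_le fun i hi => ?_
  exact ((h.homog g _ i (homogeneousComponent_isHomogeneous i p)).totalDegree_le).trans
    (Nat.lt_succ_iff.mp (Finset.mem_range.mp hi))

theorem smul_homogeneousComponent (h : IsReflectionAction k n G) (g : G)
    (p : MvPolynomial (Fin n) k) (d : ℕ) :
    g • homogeneousComponent d p = homogeneousComponent d (g • p) := by
  have h1 := congrArg (fun q => homogeneousComponent d (g • q)) (sum_homogeneousComponent p)
  simp only [Finset.smul_sum, map_sum] at h1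
  rw [← h1]
  by_cases hd : d < p.totalDegree + 1
  · rw [Finset.sum_eq_single d]
    · rw [homogeneousComponent_eq_self (h.homog g _ d (homogeneousComponent_isHomogeneous d p))]
    · intro i _ hi
      rw [homogeneousComponent_of_mem (h.homog g _ i (homogeneousComponent_isHomogeneous i p)),
        if_neg hi.symm]
    · intro hd'; exact absurd (Finset.mem_range.mpr hd) hd'
  · rw [homogeneousComponent_eq_zero d p (by omega), smul_zero]
    refine (Finset.sum_eq_zero fun i hi => ?_).symm
    rw [homogeneousComponent_of_mem (h.homog g _ i (homogeneousComponent_isHomogeneous i p)),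
      if_neg]
    rintro rfl
    exact hd (Finset.mem_range.mp hi)

/-! ### Syzygies between invariants -/

variable {ι : Type*}

theorem smul_pi_smul (s : G) (a : MvPolynomial (Fin n) k) (x : ι → MvPolynomial (Fin n) k) :
    s • (a • x) = (s • a) • (s • x) := by
  ext1 i
  simp

theorem sum_smul_sub_sum [Fintype G] (p : ι → MvPolynomial (Fin n) k) :
    (Fintype.card G : MvPolynomial (Fin n) k) • p = ∑ w : G, w • p - ∑ w : G, (w • p - p) := by
  rw [Finset.sum_sub_distrib, sub_sub_cancel, Finset.sum_const, Finset.card_univ,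
    Nat.cast_smul_eq_nsmul]

variable [Fintype ι]

variable (G) in
/-- The module generated by the invariant syzygies of a family `g`. -/
noncomputable def invSyz (g : ι → MvPolynomial (Fin n) k) :
    Submodule (MvPolynomial (Fin n) k) (ι → MvPolynomial (Fin n) k) :=
  Submodule.span _ {h | (∀ s : G, s • h = h) ∧ ∑ i, h i * g i = 0}

theorem sum_mul_eq_zero_of_mem_invSyz {g p : ι → MvPolynomial (Fin n) k}
    (hp : p ∈ invSyz G g) : ∑ i, p i * g i = 0 := by
  induction hp using Submodule.span_induction with
  | mem x hx => exact hx.2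
  | zero => simp
  | add x y _ _ hx hy => simp [add_mul, Finset.sum_add_distrib, hx, hy]
  | smul a x _ hx => simp [mul_assoc, ← Finset.mul_sum, hx]

theorem smul_mem_invSyz (s : G) {g p : ι → MvPolynomial (Fin n) k}
    (hp : p ∈ invSyz G g) : s • p ∈ invSyz G g := by
  induction hp using Submodule.span_induction with
  | mem x hx => rw [hx.1 s]; exact Submodule.subset_span hx
  | zero => rw [smul_zero]; exact zero_mem _
  | add x y _ _ hx hy => rw [smul_add]; exact add_mem hx hy
  | smul a x _ hx => rw [smul_pi_smul]; exact Submodule.smul_mem _ _ hx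

/-- All syzygies between invariants come from invariant ones. If `s` is a reflection with linear
form `l` and `p` is a syzygy, then `s p - p = l q` for a syzygy `q` of smaller degree; so, by induction,
`p` differs from its average over the group by an element of `invSyz`. -/
theorem mem_invSyz [Fintype G] [CharZero k] (h : IsReflectionAction k n G)
    {g : ι → MvPolynomial (Fin n) k} (hg : ∀ (s : G) i, s • g i = g i)
    {p : ι → MvPolynomial (Fin n) k} (hp : ∑ i, p i * g i = 0) : p ∈ invSyz G g := by
  have key (d : ℕ) : ∀ p : ι → MvPolynomial (Fin n) k, (∀ i, p i = 0 ∨ (p i).totalDegree < d) →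
      ∑ i, p i * g i = 0 → p ∈ invSyz G g := by
    induction d with
    | zero =>
      intro p hd _
      have : p = 0 := funext fun i => (hd i).resolve_right (Nat.not_lt_zero _)
      rw [this]; exact zero_mem _
    | succ d ih =>
      intro p hd hp
      have hs (w : G) : ∑ i, (w • p i) * g i = 0 := by
        have := congrArg (w • ·) hp
        simpa only [Finset.smul_sum, MulSemiringAction.smul_mul, hg, smul_zero] using this
      have hmem (w : G) : w • p - p ∈ invSyz G g := by
        have hw : w ∈ Subgroup.closure {s : G | ∃ l : MvPolynomial (Fin n) k,
            l ≠ 0 ∧ l.IsHomogeneous 1 ∧ ∀ p, l ∣ s • p - p} := by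
          rw [h.closure_eq_top]; trivial
        induction hw using Subgroup.closure_induction with
        | mem s hsl =>
          obtain ⟨l, hl0, hl1, hl⟩ := hsl
          choose q hq using fun i => hl (p i)
          have e : s • p - p = l • q := funext fun i => hq i
          rw [e]
          refine Submodule.smul_mem _ _ (ih q (fun i => ?_) ?_)
          · rw [or_iff_not_imp_left]
            intro hqi
            have h1 := totalDegree_mul_of_isDomain hl0 hqi
            have h2 := totalDegree_sub (s • p i) (p i)
            have h3 := h.totalDegree_smul_le s (p i)
            rw [hl1.totalDegree hl0, ← hq i] at h1
            rcases hd i with h4 | h4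
            · rw [h4, smul_zero, sub_zero, totalDegree_zero] at h1; omega
            · omega
          · refine mul_left_cancel₀ hl0 ?_
            rw [Finset.mul_sum, mul_zero]
            simp only [← mul_assoc, ← hq, sub_mul, Finset.sum_sub_distrib, hs, hp, sub_zero]
        | one => simp
        | mul x y _ _ hx hy =>
          have e : (x * y) • p - p = x • (y • p - p) + (x • p - p) := by
            rw [smul_sub, mul_smul]; abel
          rw [e]
          exact add_mem (smul_mem_invSyz x hy) hx
        | inv x _ hx =>
          have e : x⁻¹ • p - p = -(x⁻¹ • (x • p - p)) := by
            rw [smul_sub, inv_smul_smul]; abel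
          rw [e]
          exact neg_mem (smul_mem_invSyz _ hx)
      have h1 : (Fintype.card G : MvPolynomial (Fin n) k) • p ∈ invSyz G g := by
        rw [sum_smul_sub_sum]
        refine sub_mem (Submodule.subset_span ⟨fun s => ?_, ?_⟩) (sum_mem fun w _ => hmem w)
        · rw [Finset.smul_sum]
          simp only [← mul_smul]
          exact Fintype.sum_equiv (Equiv.mulLeft s) _ _ fun _ => rfl
        · simp only [Finset.sum_apply, Pi.smul_apply, Finset.sum_mul]
          rw [Finset.sum_comm]
          exact Finset.sum_eq_zero fun w _ => hs w
      have h2 := Submodule.smul_mem (invSyz G g) (C ((Fintype.card G : k)⁻¹)) h1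
      have h0 : (Fintype.card G : k) ≠ 0 := Nat.cast_ne_zero.mpr Fintype.card_ne_zero
      rwa [smul_smul, ← map_natCast (C : k →+* MvPolynomial (Fin n) k), ← map_mul,
        inv_mul_cancel₀ h0, map_one, one_smul] at h2
  exact key (∑ i, (p i).totalDegree + 1) p
    (fun i => Or.inr (Nat.lt_succ_of_le
      (Finset.single_le_sum (f := fun i => (p i).totalDegree) (fun _ _ => Nat.zero_le _)
        (Finset.mem_univ i)))) hp

end IsReflectionAction

end Syzygies

/-! ### Basic invariants -/

section BasicInvariants

open MvPolynomial
variable {k : Type*} [Field k] {n : ℕ} {G : Type*} [Group G]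
  [MulSemiringAction G (MvPolynomial (Fin n) k)]

variable (G) in
/-- A minimal finite family of homogeneous invariants of positive degrees `d i` that generates the
ideal of `k[x_1, …, x_n]` spanned by the invariants without constant term. -/
structure IsBasicInvariants {m : ℕ} (f : Fin m → MvPolynomial (Fin n) k) (d : Fin m → ℕ) :
    Prop where
  smul_eq : ∀ (g : G) i, g • f i = f i
  homog : ∀ i, (f i).IsHomogeneous (d i)
  pos : ∀ i, 0 < d i
  mem_span : ∀ p, (∀ g : G, g • p = p) → constantCoeff p = 0 → p ∈ Ideal.span (Set.range f)
  minimal : ∀ i, f i ∉ Ideal.span (f '' {i}ᶜ)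

theorem IsReflectionAction.exists_isBasicInvariants (h : IsReflectionAction k n G) :
    ∃ (m : ℕ) (f : Fin m → MvPolynomial (Fin n) k) (d : Fin m → ℕ),
      IsBasicInvariants G f d := by
  classical
  let T : Set (MvPolynomial (Fin n) k) :=
    {p | (∀ g : G, g • p = p) ∧ ∃ d, 0 < d ∧ p.IsHomogeneous d}
  -- A generating family of least length is minimal.
  let P : ℕ → Prop := fun m => ∃ f : Fin m → MvPolynomial (Fin n) k,
    (∀ i, f i ∈ T) ∧ Ideal.span (Set.range f) = Ideal.span T
  have hP : ∃ m, P m := by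
    obtain ⟨s, hs, he⟩ := (Submodule.fg_span_iff_fg_span_finset_subset T).mp
      (IsNoetherian.noetherian (Submodule.span (MvPolynomial (Fin n) k) T))
    refine ⟨s.card, fun i => (s.equivFin.symm i : MvPolynomial (Fin n) k),
      fun i => hs (s.equivFin.symm i).2, ?_⟩
    have : Set.range (fun i => (s.equivFin.symm i : MvPolynomial (Fin n) k)) = s := by
      ext x
      constructor
      · rintro ⟨i, rfl⟩; exact (s.equivFin.symm i).2
      · intro hx; exact ⟨s.equivFin ⟨x, hx⟩, by simp⟩
    rw [this]
    exact he.symm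
  obtain ⟨f, hfT, hf⟩ := Nat.find_spec hP
  have hmin := fun m hm => Nat.find_min hP (m := m) hm
  generalize Nat.find hP = m at f hmin
  choose d hd using fun i => (hfT i).2
  refine ⟨m, f, d, fun g i => (hfT i).1 g, fun i => (hd i).2, fun i => (hd i).1, ?_, ?_⟩
  · intro p hp h0
    rw [hf, ← sum_homogeneousComponent p]
    refine sum_mem fun i _ => ?_
    rcases Nat.eq_zero_or_pos i with rfl | hi
    · rw [homogeneousComponent_zero]
      rw [constantCoeff_eq] at h0
      rw [h0, map_zero]; exact zero_mem _
    · refine Ideal.subset_span ⟨fun g => ?_, i, hi, homogeneousComponent_isHomogeneous i p⟩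
      rw [h.smul_homogeneousComponent, hp]
  · intro i hi
    rcases m with _ | m
    · exact i.elim0
    refine hmin m (Nat.lt_succ_self m) ⟨f ∘ i.succAbove, fun j => hfT _, ?_⟩
    have e : Set.range (f ∘ i.succAbove) = f '' {i}ᶜ := by
      rw [Set.range_comp, Fin.range_succAbove]
    rw [e, ← hf]
    refine le_antisymm (Ideal.span_mono (Set.image_subset_range _ _)) (Ideal.span_le.mpr ?_)
    rintro _ ⟨j, rfl⟩
    by_cases hj : j = i
    · rw [hj]; exact hi
    · exact Ideal.subset_span ⟨j, hj, rfl⟩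

namespace IsBasicInvariants

variable {m : ℕ} {f : Fin m → MvPolynomial (Fin n) k} {d : Fin m → ℕ}

/-- By minimality, the coefficients of a relation between the basic invariants have no constant
terms: otherwise the part of degree `d i` would express `f i` through the others. -/
theorem constantCoeff_eq_zero (hb : IsBasicInvariants G f d)
    {r : Fin m → MvPolynomial (Fin n) k} (hr : ∑ i, r i * f i = 0) (i : Fin m) :
    constantCoeff (r i) = 0 := by
  classical
  by_contra hc
  have ht (j : Fin m) : ∃ t, homogeneousComponent (d i) (r j * f j) = t * f j := by
    by_cases hj : d j ≤ d i
    · have := homogeneousComponent_add_mul (hb.homog j) (d i - d j) (r j)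
      rw [Nat.sub_add_cancel hj] at this
      exact ⟨_, this⟩
    · exact ⟨0, by rw [zero_mul, homogeneousComponent_mul_of_lt (hb.homog j) (not_le.mp hj)]⟩
  choose t ht using ht
  have hi := homogeneousComponent_add_mul (hb.homog i) 0 (r i)
  rw [zero_add, homogeneousComponent_zero, ← constantCoeff_eq] at hi
  have hs := congrArg (homogeneousComponent (d i)) hr
  rw [map_sum, map_zero, ← Finset.add_sum_erase _ _ (Finset.mem_univ i), hi,
    add_eq_zero_iff_eq_neg] at hs
  refine hb.minimal i ?_
  have h1 : C (constantCoeff (r i)) * f i ∈ Ideal.span (f '' {i}ᶜ) := by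
    rw [hs]
    refine neg_mem (sum_mem fun j hj => ?_)
    rw [ht]
    exact Ideal.mul_mem_left _ _ (Ideal.subset_span ⟨j, Finset.ne_of_mem_erase hj, rfl⟩)
  have h2 := Ideal.mul_mem_left _ (C (constantCoeff (r i))⁻¹) h1
  rwa [← mul_assoc, ← map_mul, inv_mul_cancel₀ hc, map_one, one_mul] at h2

/-- The basic invariants generate the algebra of invariants, by induction on the degree: the
coefficients of a homogeneous invariant as a combination of the `f i` can be taken homogeneous of
smaller degree and, after averaging, invariant. -/
theorem mem_adjoin [Fintype G] [CharZero k] (h : IsReflectionAction k n G)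
    (hb : IsBasicInvariants G f d) {p : MvPolynomial (Fin n) k} (hp : ∀ g : G, g • p = p) :
    p ∈ Algebra.adjoin k (Set.range f) := by
  have key (e : ℕ) : ∀ p : MvPolynomial (Fin n) k, p.IsHomogeneous e → (∀ g : G, g • p = p) →
      p ∈ Algebra.adjoin k (Set.range f) := by
    induction e using Nat.strong_induction_on with
    | _ e ih =>
      intro p hpe hp
      rcases Nat.eq_zero_or_pos e with rfl | he
      · rw [totalDegree_eq_zero_iff_eq_C.mp (Nat.le_zero.mp hpe.totalDegree_le)]
        exact Subalgebra.algebraMap_mem _ _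
      have h0 : constantCoeff p = 0 := by
        rw [constantCoeff_eq]
        exact hpe.coeff_eq_zero (by simpa using he.ne)
      obtain ⟨r, hr⟩ := Ideal.mem_span_range_iff_exists_fun.mp (hb.mem_span p hp h0)
      have ht (j : Fin m) : ∃ t, homogeneousComponent e (r j * f j) = t * f j ∧
          ∃ e' < e, t.IsHomogeneous e' := by
        by_cases hj : d j ≤ e
        · have := homogeneousComponent_add_mul (hb.homog j) (e - d j) (r j)
          rw [Nat.sub_add_cancel hj] at this
          have := hb.pos j
          exact ⟨_, ‹_›, e - d j, by omega, homogeneousComponent_isHomogeneous _ _⟩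
        · exact ⟨0, by rw [zero_mul, homogeneousComponent_mul_of_lt (hb.homog j) (not_le.mp hj)],
            0, he, isHomogeneous_zero _ _ _⟩
      choose t ht e' he' hte using ht
      have hpt : p = ∑ j, t j * f j := by
        rw [← homogeneousComponent_eq_self hpe, ← hr, map_sum]
        exact Finset.sum_congr rfl fun j _ => ht j
      have hs : (Fintype.card G : MvPolynomial (Fin n) k) * p =
          ∑ j, (∑ g : G, g • t j) * f j := by
        have h1 : ∑ g : G, g • p = (Fintype.card G : MvPolynomial (Fin n) k) * p := by
          simp [hp]
        rw [← h1]
        conv_lhs => rw [hpt]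
        simp only [Finset.smul_sum, MulSemiringAction.smul_mul, hb.smul_eq, Finset.sum_mul]
        rw [Finset.sum_comm]
      have hmem : (Fintype.card G : MvPolynomial (Fin n) k) * p ∈
          Algebra.adjoin k (Set.range f) := by
        rw [hs]
        refine sum_mem fun j _ => mul_mem (ih _ (he' j) _ ?_ ?_) (Algebra.subset_adjoin ⟨j, rfl⟩)
        · exact IsHomogeneous.sum _ _ _ fun g _ => h.homog g _ _ (hte j)
        · intro g
          rw [Finset.smul_sum]
          simp only [← mul_smul]
          exact Fintype.sum_equiv (Equiv.mulLeft g) _ _ fun _ => rfl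
      have hc : (Fintype.card G : k) ≠ 0 := Nat.cast_ne_zero.mpr Fintype.card_ne_zero
      have h2 := Subalgebra.smul_mem _ hmem ((Fintype.card G : k)⁻¹)
      rwa [smul_eq_C_mul, ← mul_assoc, ← map_natCast (C : k →+* MvPolynomial (Fin n) k),
        ← map_mul, inv_mul_cancel₀ hc, map_one, one_mul] at h2
  rw [← sum_homogeneousComponent p]
  refine sum_mem fun i _ => key i _ (homogeneousComponent_isHomogeneous i p) fun g => ?_
  rw [h.smul_homogeneousComponent, hp]

/-- The gradients of the basic invariants admit no nontrivial invariant relation. By Euler's formula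
and `mem_invSyz`, such a relation `g` expresses the vector of the `d i • f i` as a combination
`∑ b, f b • N b` of syzygies `N b` of `g`; the matrix `N` is diagonal with entries `d i` at the
origin, hence invertible, and `N g = 0`. -/
theorem eq_zero_of_sum_pderiv_eq_zero [Fintype G] [CharZero k] (h : IsReflectionAction k n G)
    (hb : IsBasicInvariants G f d) {g : Fin m → MvPolynomial (Fin n) k}
    (hg : ∀ (s : G) i, s • g i = g i) (hrel : ∀ l, ∑ i, pderiv l (f i) * g i = 0) : g = 0 := by
  classical
  let S := IsReflectionAction.invSyz G g
  let I : Ideal (MvPolynomial (Fin n) k) := Ideal.span (Set.range f)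
  have hp (l : Fin n) : (fun i => pderiv l (f i)) ∈ S := h.mem_invSyz hg (hrel l)
  let v : Fin m → MvPolynomial (Fin n) k := fun i => d i • f i
  have hv : v = ∑ l, (X l : MvPolynomial (Fin n) k) • fun i => pderiv l (f i) := by
    ext1 i
    simp only [Finset.sum_apply, Pi.smul_apply, smul_eq_mul]
    exact ((hb.homog i).sum_X_mul_pderiv).symm
  have hconst (s : G) (r : MvPolynomial (Fin n) k) (hr : constantCoeff r = 0) :
      constantCoeff (s • r) = 0 := by
    have := h.smul_homogeneousComponent s r 0
    rw [homogeneousComponent_zero, homogeneousComponent_zero, ← constantCoeff_eq,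
      hr, map_zero, smul_zero] at this
    exact (C_eq_zero.mp this.symm)
  have havg (x : Fin m → MvPolynomial (Fin n) k) (hx : x ∈ S) :
      ∀ r : MvPolynomial (Fin n) k, constantCoeff r = 0 → ∑ s : G, s • (r • x) ∈ I • S := by
    induction hx using Submodule.span_induction with
    | mem x hx =>
      intro r hr
      simp only [IsReflectionAction.smul_pi_smul, hx.1, ← Finset.sum_smul]
      refine Submodule.smul_mem_smul (hb.mem_span _ (fun g => ?_) ?_) (Submodule.subset_span hx)
      · rw [Finset.smul_sum]
        simp only [← mul_smul]
        exact Fintype.sum_equiv (Equiv.mulLeft g) _ _ fun _ => rfl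
      · rw [map_sum]
        exact Finset.sum_eq_zero fun s _ => hconst s r hr
    | zero => intro r _; simp
    | add x y _ _ hx hy =>
      intro r hr
      simp only [smul_add, Finset.sum_add_distrib]
      exact add_mem (hx r hr) (hy r hr)
    | smul a x _ hx =>
      intro r hr
      simp only [smul_smul r a]
      exact hx (r * a) (by rw [map_mul, hr, zero_mul])
  have hv1 : ∑ s : G, s • v ∈ I • S := by
    rw [hv]
    simp only [Finset.smul_sum]
    rw [Finset.sum_comm]
    exact sum_mem fun l _ => havg _ (hp l) _ (constantCoeff_X _ l)
  have hv2 : ∑ s : G, s • v = (Fintype.card G : MvPolynomial (Fin n) k) • v := by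
    have (s : G) : s • v = v := by
      ext1 i
      simp only [v, Pi.smul_apply, nsmul_eq_mul, MulSemiringAction.smul_mul, hb.smul_eq]
      rw [← MulSemiringAction.toRingHom_apply G, map_natCast]
    simp only [this, Finset.sum_const, Finset.card_univ, Nat.cast_smul_eq_nsmul]
  have hv3 : v ∈ I • S := by
    have hc : (Fintype.card G : k) ≠ 0 := Nat.cast_ne_zero.mpr Fintype.card_ne_zero
    have h2 := Submodule.smul_mem _ (C ((Fintype.card G : k)⁻¹)) (hv2 ▸ hv1)
    rwa [smul_smul, ← map_natCast (C : k →+* MvPolynomial (Fin n) k),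
        ← map_mul, inv_mul_cancel₀ hc, map_one, one_smul] at h2
  have hrep (u : Fin m → MvPolynomial (Fin n) k) (hu : u ∈ I • S) :
      ∃ N : Fin m → Fin m → MvPolynomial (Fin n) k, (∀ b, N b ∈ S) ∧ u = ∑ b, f b • N b := by
    induction hu using Submodule.smul_induction_on' with
    | smul r hr x hx =>
      obtain ⟨a, rfl⟩ := Ideal.mem_span_range_iff_exists_fun.mp hr
      refine ⟨fun b => a b • x, fun b => Submodule.smul_mem _ _ hx, ?_⟩
      rw [Finset.sum_smul]
      exact Finset.sum_congr rfl fun b _ => by rw [smul_smul, mul_comm]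
    | add x _ y _ hx hy =>
      obtain ⟨N, hN, rfl⟩ := hx
      obtain ⟨N', hN', rfl⟩ := hy
      exact ⟨N + N', fun b => add_mem (hN b) (hN' b), by
        simp [Finset.sum_add_distrib]⟩
  obtain ⟨N, hN, hvN⟩ := hrep v hv3
  have hNc (b i : Fin m) : constantCoeff (N b i) = if b = i then (d i : k) else 0 := by
    have hz : ∑ b, (N b i - if b = i then (d i : MvPolynomial (Fin n) k) else 0) * f b = 0 := by
      simp only [sub_mul, ite_mul, zero_mul, Finset.sum_sub_distrib, Finset.sum_ite_eq',
        Finset.mem_univ, if_true]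
      have := congrFun hvN i
      simp only [v, Finset.sum_apply, Pi.smul_apply, smul_eq_mul, nsmul_eq_mul] at this
      rw [this, sub_eq_zero]
      exact Finset.sum_congr rfl fun b _ => mul_comm _ _
    have := hb.constantCoeff_eq_zero hz b
    rw [map_sub, sub_eq_zero] at this
    rw [this]
    split_ifs <;> simp
  have hdet : (Matrix.of N).det ≠ 0 := by
    intro h0
    have h1 : ((Matrix.of N).map constantCoeff).det = 0 := by
      have := RingHom.map_det constantCoeff (Matrix.of N)
      rw [h0, map_zero] at this
      exact this.symm
    have h2 : (Matrix.of N).map constantCoeff = Matrix.diagonal fun i => (d i : k) := by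
      ext b i
      rw [Matrix.map_apply, Matrix.of_apply, hNc, Matrix.diagonal_apply]
      split_ifs with hbi
      · rw [hbi]
      · rfl
    rw [h2, Matrix.det_diagonal, Finset.prod_eq_zero_iff] at h1
    obtain ⟨i, _, hi⟩ := h1
    exact (hb.pos i).ne' (Nat.cast_eq_zero.mp hi)
  refine Matrix.eq_zero_of_mulVec_eq_zero hdet ?_
  ext1 b
  exact IsReflectionAction.sum_mul_eq_zero_of_mem_invSyz (hN b)

end IsBasicInvariants

end BasicInvariants

/-! ### Gradients of the basic invariants -/

section Gradients

open MvPolynomial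
variable {k : Type*} [Field k] {n : ℕ}

theorem MvPolynomial.derivation_eq_sum_pderiv
    (E : Derivation k (MvPolynomial (Fin n) k) (MvPolynomial (Fin n) k))
    (p : MvPolynomial (Fin n) k) : E p = ∑ l, E (X l) * pderiv l p := by
  induction p using MvPolynomial.induction_on with
  | C c => simp
  | add p q hp hq => simp only [map_add, hp, hq, mul_add, Finset.sum_add_distrib]
  | mul_X p i hp =>
    classical
    simp only [Derivation.leibniz, hp, smul_eq_mul, pderiv_X, mul_add, Finset.sum_add_distrib,
      Finset.mul_sum, Pi.single_apply, mul_ite, mul_one, mul_zero,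
      Finset.mem_univ, if_true, Finset.sum_ite_eq]
    rw [mul_comm p]
    exact congrArg _ (Finset.sum_congr rfl fun l _ => mul_left_comm _ _ _)

/-- The conjugate `σ ∘ E ∘ σ⁻¹` of a derivation by an automorphism. -/
def Derivation.conj {A : Type*} [CommRing A] [Algebra k A] (σ : A ≃ₐ[k] A)
    (E : Derivation k A A) : Derivation k A A :=
  Derivation.mk' (σ.toLinearMap ∘ₗ E.toLinearMap ∘ₗ σ.symm.toLinearMap) fun a b => by
    simp

@[simp] theorem Derivation.conj_apply {A : Type*} [CommRing A] [Algebra k A] (σ : A ≃ₐ[k] A)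
    (E : Derivation k A A) (a : A) : E.conj σ a = σ (E (σ.symm a)) := rfl

namespace IsBasicInvariants

variable {G : Type*} [Group G]
  [MulSemiringAction G (MvPolynomial (Fin n) k)]
variable {m : ℕ} {f : Fin m → MvPolynomial (Fin n) k} {d : Fin m → ℕ}

/-- A relation with a nonzero coefficient can be scaled and averaged to an invariant one. -/
theorem linearIndependent_pderiv [SMulCommClass G k (MvPolynomial (Fin n) k)]
    [Fintype G] [CharZero k] (h : IsReflectionAction k n G)
    (hb : IsBasicInvariants G f d) :
    LinearIndependent (MvPolynomial (Fin n) k) (fun i l => pderiv l (f i)) := by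
  classical
  rw [Fintype.linearIndependent_iff]
  intro c hc i₀
  by_contra hi₀
  have hrel (E : Derivation k (MvPolynomial (Fin n) k) (MvPolynomial (Fin n) k)) :
      ∑ i, c i * E (f i) = 0 := by
    rw [Finset.sum_congr rfl fun i _ =>
      congrArg (c i * ·) (MvPolynomial.derivation_eq_sum_pderiv E (f i))]
    simp only [Finset.mul_sum]
    rw [Finset.sum_comm]
    refine Finset.sum_eq_zero fun l _ => ?_
    have := congrFun hc l
    simp only [Finset.sum_apply, Pi.smul_apply, smul_eq_mul, Pi.zero_apply] at this
    simp only [mul_left_comm _ (E (X l)), ← Finset.mul_sum, this, mul_zero]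
  -- The factor that turns the coefficient `c i₀` into its norm.
  let q : MvPolynomial (Fin n) k := ∏ s ∈ Finset.univ.erase (1 : G), s • c i₀
  let g : Fin m → MvPolynomial (Fin n) k := fun i => ∑ s : G, s • (q * c i)
  have hgi (s : G) (i : Fin m) : s • g i = g i := by
    simp only [g]
    rw [Finset.smul_sum]
    simp only [← mul_smul]
    exact Fintype.sum_equiv (Equiv.mulLeft s) _ _ fun _ => rfl
  have hg (E : Derivation k (MvPolynomial (Fin n) k) (MvPolynomial (Fin n) k)) :
      ∑ i, E (f i) * g i = 0 := by
    simp only [g, Finset.mul_sum]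
    rw [Finset.sum_comm]
    refine Finset.sum_eq_zero fun s _ => ?_
    have h1 := congrArg (fun r => s • (q * r))
      (hrel (E.conj (MulSemiringAction.toAlgEquiv k (MvPolynomial (Fin n) k) s).symm))
    simp only [Derivation.conj_apply, AlgEquiv.symm_symm, mul_zero, smul_zero,
      MulSemiringAction.toAlgEquiv_apply, hb.smul_eq, Finset.mul_sum, Finset.smul_sum] at h1
    rw [← h1]
    refine Finset.sum_congr rfl fun i _ => ?_
    have h2 : s • (MulSemiringAction.toAlgEquiv k (MvPolynomial (Fin n) k) s).symm (E (f i)) =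
      E (f i) := (MulSemiringAction.toAlgEquiv k (MvPolynomial (Fin n) k) s).apply_symm_apply _
    rw [← mul_assoc, MulSemiringAction.smul_mul s (q * c i), h2, mul_comm]
  have h0 := congrFun (hb.eq_zero_of_sum_pderiv_eq_zero h hgi fun l => hg (pderiv l)) i₀
  have hq : q * c i₀ = ∏ s : G, s • c i₀ := by
    rw [← Finset.prod_erase_mul _ _ (Finset.mem_univ (1 : G)), one_smul]
  have hinv (s : G) : s • ∏ w : G, w • c i₀ = ∏ w : G, w • c i₀ := by
    rw [Finset.smul_prod']
    simp only [← mul_smul]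
    exact Fintype.prod_equiv (Equiv.mulLeft s) _ _ fun _ => rfl
  simp only [g, hq, hinv, Finset.sum_const, Pi.zero_apply, nsmul_eq_mul, mul_eq_zero,
    Finset.prod_eq_zero_iff, Finset.card_univ, Nat.cast_eq_zero, Fintype.card_ne_zero,
    false_or] at h0
  obtain ⟨s, _, hs⟩ := h0
  exact hi₀ ((smul_eq_zero_iff_eq s).mp hs)

theorem card_le [SMulCommClass G k (MvPolynomial (Fin n) k)]
    [Fintype G] [CharZero k] (h : IsReflectionAction k n G)
    (hb : IsBasicInvariants G f d) : m ≤ n := by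
  have := (hb.linearIndependent_pderiv h).fintype_card_le_finrank
  simpa using this

end IsBasicInvariants

end Gradients

/-! ### Derivations of the field of rational functions -/

section RationalFunctions

open MvPolynomial
variable {k : Type*} [Field k] {n : ℕ}

theorem Derivation.sum_smul_apply {A ι : Type*} [CommRing A] [Algebra k A] [Fintype ι]
    (c : ι → A) (D : ι → Derivation k A A) (a : A) :
    (∑ i, c i • D i) a = ∑ i, c i * D i a := by
  have := congrFun (map_sum (Derivation.coeFnAddMonoidHom (R := k) (A := A) (M := A))
    (fun i => c i • D i) Finset.univ) a
  rw [Finset.sum_apply] at this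
  exact this

/-- The field of rational functions in `x_1, …, x_n`. -/
abbrev RatFunField (k : Type*) [Field k] (n : ℕ) : Type _ :=
  FractionRing (MvPolynomial (Fin n) k)

namespace RatFunField

/-- The inclusion of the polynomials. -/
noncomputable abbrev ofPoly (k : Type*) [Field k] (n : ℕ) :
    MvPolynomial (Fin n) k →ₐ[k] RatFunField k n :=
  IsScalarTower.toAlgHom k (MvPolynomial (Fin n) k) (RatFunField k n)

theorem ofPoly_injective : Function.Injective (ofPoly k n) :=
  IsFractionRing.injective (MvPolynomial (Fin n) k) (RatFunField k n)

theorem exists_eq_div (a : RatFunField k n) :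
    ∃ p q : MvPolynomial (Fin n) k, q ≠ 0 ∧ a = ofPoly k n p / ofPoly k n q := by
  obtain ⟨p, q, hq, rfl⟩ := IsFractionRing.div_surjective (MvPolynomial (Fin n) k) a
  exact ⟨p, q, nonZeroDivisors.ne_zero hq, rfl⟩

theorem derivation_ofPoly_eq_zero (E : Derivation k (RatFunField k n) (RatFunField k n))
    {s : Set (MvPolynomial (Fin n) k)} (hE : ∀ p ∈ s, E (ofPoly k n p) = 0)
    {p : MvPolynomial (Fin n) k} (hp : p ∈ Algebra.adjoin k s) : E (ofPoly k n p) = 0 := by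
  induction hp using Algebra.adjoin_induction with
  | mem x hx => exact hE x hx
  | algebraMap c => rw [AlgHom.commutes, Derivation.map_algebraMap]
  | add x y _ _ hx hy => rw [map_add, map_add, hx, hy, add_zero]
  | mul x y _ _ hx hy => rw [map_mul, Derivation.leibniz, hx, hy, smul_zero, smul_zero, add_zero]

theorem derivation_div_eq_zero {E : Derivation k (RatFunField k n) (RatFunField k n)}
    {a b : RatFunField k n} (ha : E a = 0) (hb : E b = 0) : E (a / b) = 0 := by
  rw [Derivation.leibniz_div, ha, hb]
  simp

theorem derivation_ext {E E' : Derivation k (RatFunField k n) (RatFunField k n)}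
    (h : ∀ l, E (ofPoly k n (X l)) = E' (ofPoly k n (X l))) : E = E' := by
  rw [← sub_eq_zero]
  ext a
  obtain ⟨p, q, _, rfl⟩ := exists_eq_div a
  have key (p : MvPolynomial (Fin n) k) : (E - E') (ofPoly k n p) = 0 := by
    refine derivation_ofPoly_eq_zero _ (s := Set.range X) ?_
      (by rw [MvPolynomial.adjoin_range_X]; trivial)
    rintro _ ⟨l, rfl⟩
    rw [Derivation.sub_apply, h, sub_self]
  exact derivation_div_eq_zero (key p) (key q)

/-- The ring homomorphism `a ↦ a + ε ∂a/∂x_l` into the dual numbers over `k(x)`. -/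
noncomputable def dualHom (k : Type*) [Field k] {n : ℕ} (l : Fin n) :
    RatFunField k n →+* TrivSqZeroExt (RatFunField k n) (RatFunField k n) :=
  IsLocalization.lift (M := (MvPolynomial (Fin n) k)⁰) (g :=
    { toFun := fun p => (TrivSqZeroExt.inl (ofPoly k n p) +
        TrivSqZeroExt.inr (ofPoly k n (pderiv l p)) :
        TrivSqZeroExt (RatFunField k n) (RatFunField k n))
      map_one' := by simp
      map_zero' := by simp
      map_add' := fun p q => by
        simp only [map_add, TrivSqZeroExt.inl_add, TrivSqZeroExt.inr_add]
        abel
      map_mul' := fun p q => by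
        ext
        · simp
        · simp only [Derivation.leibniz, smul_eq_mul, map_add, map_mul, TrivSqZeroExt.snd_add,
            TrivSqZeroExt.snd_inl, TrivSqZeroExt.snd_inr, TrivSqZeroExt.snd_mul,
            TrivSqZeroExt.fst_add, TrivSqZeroExt.fst_inl, TrivSqZeroExt.fst_inr, zero_add,
            add_zero, op_smul_eq_smul, smul_eq_mul] })
    (fun q => by
      rw [TrivSqZeroExt.isUnit_iff_isUnit_fst, isUnit_iff_ne_zero]
      simp)

theorem dualHom_ofPoly (l : Fin n) (p : MvPolynomial (Fin n) k) :
    dualHom k l (ofPoly k n p) =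
      TrivSqZeroExt.inl (ofPoly k n p) + TrivSqZeroExt.inr (ofPoly k n (pderiv l p)) :=
  IsLocalization.lift_eq _ _

theorem fst_dualHom (l : Fin n) (a : RatFunField k n) : (dualHom k l a).fst = a := by
  have : (TrivSqZeroExt.fstHom (RatFunField k n) (RatFunField k n)
      (RatFunField k n)).toRingHom.comp (dualHom k l) = RingHom.id _ := by
    refine IsLocalization.ringHom_ext (MvPolynomial (Fin n) k)⁰ (RingHom.ext fun p => ?_)
    have := congrArg TrivSqZeroExt.fst (dualHom_ofPoly (k := k) l p)
    simpa using this
  exact RingHom.congr_fun this a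

/-- The partial derivative `∂/∂x_l` on rational functions. -/
noncomputable def partialDeriv (k : Type*) [Field k] {n : ℕ} (l : Fin n) :
    Derivation k (RatFunField k n) (RatFunField k n) :=
  Derivation.mk'
    { toFun := fun a => (dualHom k l a).snd
      map_add' := fun a b => by simp
      map_smul' := fun c a => by
        have hc : dualHom k l (algebraMap k _ c) = TrivSqZeroExt.inl (algebraMap k _ c) := by
          have := dualHom_ofPoly l (algebraMap k (MvPolynomial (Fin n) k) c)
          rwa [AlgHom.commutes, Derivation.map_algebraMap, map_zero, TrivSqZeroExt.inr_zero,
            add_zero] at this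
        rw [Algebra.smul_def, map_mul, hc]
        simp [Algebra.smul_def] }
    (fun a b => by
      simp [fst_dualHom, mul_comm (dualHom k l a).snd])

@[simp] theorem partialDeriv_ofPoly (l : Fin n) (p : MvPolynomial (Fin n) k) :
    partialDeriv k l (ofPoly k n p) = ofPoly k n (pderiv l p) := by
  have := congrArg TrivSqZeroExt.snd (dualHom_ofPoly (k := k) l p)
  rwa [TrivSqZeroExt.snd_add, TrivSqZeroExt.snd_inl, TrivSqZeroExt.snd_inr, zero_add] at this

/-- The vector field `∑ c_l ∂/∂x_l`. -/
noncomputable def vectorField (c : Fin n → RatFunField k n) :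
    Derivation k (RatFunField k n) (RatFunField k n) := ∑ l, c l • partialDeriv k l

theorem vectorField_apply (c : Fin n → RatFunField k n) (a : RatFunField k n) :
    vectorField c a = ∑ l, c l * partialDeriv k l a :=
  Derivation.sum_smul_apply _ _ _

theorem vectorField_X (c : Fin n → RatFunField k n) (l : Fin n) :
    vectorField c (ofPoly k n (X l)) = c l := by
  classical
  simp only [vectorField_apply, partialDeriv_ofPoly, pderiv_X, Pi.single_apply]
  simp [apply_ite]

theorem derivation_apply (E : Derivation k (RatFunField k n) (RatFunField k n))
    (a : RatFunField k n) :
    E a = ∑ l, E (ofPoly k n (X l)) * partialDeriv k l a := by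
  rw [← vectorField_apply fun l => E (ofPoly k n (X l))]
  congr 1
  exact derivation_ext fun l =>
    (vectorField_X (fun l => E (ofPoly k n (X l))) l).symm

end RatFunField

open RatFunField

/-- A derivation that vanishes on a subfield over which the field is separable is zero. -/
theorem Derivation.eq_zero_of_subfield {K : Type*} [Field K] [Algebra k K] (F : Subfield K)
    [Algebra.IsSeparable F K] (E : Derivation k K K) (hE : ∀ a ∈ F, E a = 0) : E = 0 := by
  have : Algebra.FormallyUnramified F K := Algebra.FormallyUnramified.of_isSeparable F K
  let E' : Derivation F K K := Derivation.mk'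
    { toFun := E
      map_add' := map_add E
      map_smul' := fun c a => by
        rw [Subfield.smul_def, smul_eq_mul, Derivation.leibniz, hE c c.2, smul_zero, add_zero]
        rfl }
    (fun a b => E.leibniz a b)
  have h : E' = 0 := by
    rw [← E'.liftKaehlerDifferential_comp,
      Subsingleton.elim E'.liftKaehlerDifferential 0]
    ext; rfl
  ext a
  exact congrArg (fun D => D a) h

namespace IsBasicInvariants

variable {G : Type*} [Group G]
  [MulSemiringAction G (MvPolynomial (Fin n) k)]
variable {m : ℕ} {f : Fin m → MvPolynomial (Fin n) k} {d : Fin m → ℕ}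
variable [MulSemiringAction G (RatFunField k n)]
  [SMulDistribClass G (MvPolynomial (Fin n) k) (RatFunField k n)]

theorem smul_ofPoly (g : G) (p : MvPolynomial (Fin n) k) :
    g • ofPoly k n p = ofPoly k n (g • p) := by
  exact (algebraMap.coe_smul' g p (RatFunField k n)).symm

/-- Invariant rational functions are rational functions of the basic invariants: multiply the
numerator and the denominator by the other conjugates of the denominator. -/
theorem exists_eq_div [Fintype G] [CharZero k] (h : IsReflectionAction k n G)
    (hb : IsBasicInvariants G f d) {a : RatFunField k n} (ha : ∀ g : G, g • a = a) :
    ∃ p ∈ Algebra.adjoin k (Set.range f), ∃ q ∈ Algebra.adjoin k (Set.range f),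
      a = ofPoly k n p / ofPoly k n q := by
  classical
  obtain ⟨p, q, hq, rfl⟩ := RatFunField.exists_eq_div a
  set r := ∏ s ∈ Finset.univ.erase (1 : G), s • q
  have hqr : q * r = ∏ s : G, s • q := by
    rw [← Finset.mul_prod_erase _ _ (Finset.mem_univ (1 : G)), one_smul]
  have hinv (s : G) : s • (q * r) = q * r := by
    rw [hqr, Finset.smul_prod']
    simp only [← mul_smul]
    exact Fintype.prod_equiv (Equiv.mulLeft s) _ _ fun _ => rfl
  have hqr0 : q * r ≠ 0 := by
    rw [hqr, Finset.prod_ne_zero_iff]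
    exact fun s _ => (smul_ne_zero_iff_ne s).mpr hq
  have h0 {p : MvPolynomial (Fin n) k} (hp : p ≠ 0) : ofPoly k n p ≠ 0 :=
    (map_ne_zero_iff _ ofPoly_injective).mpr hp
  have e : ofPoly k n p / ofPoly k n q = ofPoly k n (p * r) / ofPoly k n (q * r) := by
    rw [map_mul, map_mul, mul_div_mul_right _ _ (h0 (right_ne_zero_of_mul hqr0))]
  refine ⟨p * r, hb.mem_adjoin h fun g => ?_, q * r, hb.mem_adjoin h hinv, e⟩
  have := ha g
  rw [e, smul_div₀', smul_ofPoly, smul_ofPoly, hinv, div_left_inj' (h0 hqr0)] at this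
  exact ofPoly_injective this

theorem derivation_eq_zero [Fintype G] [CharZero k] (h : IsReflectionAction k n G)
    (hb : IsBasicInvariants G f d) (E : Derivation k (RatFunField k n) (RatFunField k n))
    (hE : ∀ i, E (ofPoly k n (f i)) = 0) : E = 0 := by
  refine E.eq_zero_of_subfield (FixedPoints.subfield G (RatFunField k n)) fun a ha => ?_
  obtain ⟨p, hp, q, hq, rfl⟩ := hb.exists_eq_div h ha
  have hs : ∀ p ∈ Set.range f, E (ofPoly k n p) = 0 := by
    rintro _ ⟨i, rfl⟩; exact hE i
  exact derivation_div_eq_zero (derivation_ofPoly_eq_zero E hs hp)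
    (derivation_ofPoly_eq_zero E hs hq)

end IsBasicInvariants

/-- The Chevalley-Shephard-Todd theorem in the form needed here: the invariant rational functions
are generated by `n` invariant polynomials, which are coordinates in the sense that the derivations
of `k(x)` have a dual basis. -/
theorem IsReflectionAction.exists_coordinates {G : Type*} [Group G] [Fintype G] [CharZero k]
    [MulSemiringAction G (MvPolynomial (Fin n) k)]
    [SMulCommClass G k (MvPolynomial (Fin n) k)] [MulSemiringAction G (RatFunField k n)]
    [SMulDistribClass G (MvPolynomial (Fin n) k) (RatFunField k n)]
    (h : IsReflectionAction k n G) :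
    ∃ (f : Fin n → MvPolynomial (Fin n) k)
      (D : Fin n → Derivation k (RatFunField k n) (RatFunField k n)),
      (∀ (g : G) i, g • f i = f i) ∧
      (∀ i j, D i (ofPoly k n (f j)) = if i = j then 1 else 0) ∧
      (∀ E : Derivation k (RatFunField k n) (RatFunField k n),
        (∀ i, E (ofPoly k n (f i)) = 0) → E = 0) ∧
      ∀ a : RatFunField k n, (∀ g : G, g • a = a) →
        ∃ p ∈ Algebra.adjoin k (Set.range f), ∃ q ∈ Algebra.adjoin k (Set.range f),
          a = ofPoly k n p / ofPoly k n q := by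
  classical
  obtain ⟨m, f, d, hb⟩ := h.exists_isBasicInvariants
  -- `Φ` is injective, since a derivation that vanishes on the `f i` is zero, and a dual basis is
  -- a preimage of the standard basis.
  let Φ : (Fin n → RatFunField k n) →ₗ[RatFunField k n] (Fin m → RatFunField k n) :=
    { toFun := fun c i => vectorField c (ofPoly k n (f i))
      map_add' := fun c c' => by
        ext i; simp [vectorField_apply, add_mul, Finset.sum_add_distrib]
      map_smul' := fun a c => by
        ext i; simp [vectorField_apply, mul_assoc, Finset.mul_sum] }
  have hΦ : Function.Injective Φ := by
    rw [← LinearMap.ker_eq_bot, LinearMap.ker_eq_bot']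
    intro c hc
    have := hb.derivation_eq_zero h (vectorField c) fun i => congrFun hc i
    ext1 l
    rw [← vectorField_X c l, this]
    rfl
  have hle : n ≤ m := by simpa using LinearMap.finrank_le_finrank_of_injective hΦ
  obtain rfl : m = n := le_antisymm (hb.card_le h) hle
  choose c hc using fun i : Fin m =>
    LinearMap.injective_iff_surjective.mp hΦ (fun j => if i = j then 1 else 0)
  exact ⟨f, fun i => vectorField (c i), hb.smul_eq, fun i j => congrFun (hc i) j,
    hb.derivation_eq_zero h, fun a ha => hb.exists_eq_div h ha⟩

end RationalFunctions

/-! ### Simplicity of the Weyl algebra -/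

section WeylField

open MvPolynomial

namespace WeylAlgebra

variable {k : Type*} [Field k] {n : ℕ}

theorem symb_x_mul (i : Fin n) (a : WeylAlgebra k n) :
    symb k n (x k i * a) = X (Sum.inl i) * symb k n a := by
  rw [symb_mul, act_x]

theorem symb_d_mul (i : Fin n) (a : WeylAlgebra k n) :
    symb k n (d k i * a) =
      X (Sum.inr i) * symb k n a + pderiv (Sum.inl i) (symb k n a) := by
  rw [symb_mul, act_d]

theorem symb_one : symb k n 1 = 1 := by
  simp [symb_apply]

theorem symb_mul_x (i : Fin n) (a : WeylAlgebra k n) :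
    symb k n (a * x k i) =
      X (Sum.inl i) * symb k n a + pderiv (Sum.inr i) (symb k n a) := by
  classical
  induction a using induction_left with
  | one =>
    have := symb_x_mul (k := k) i 1
    rw [mul_one] at this
    simp [this, symb_one]
  | add a b ha hb => simp only [add_mul, map_add, ha, hb, mul_add]; ring
  | smul c a ha => simp only [smul_mul_assoc, map_smul, ha, smul_add, mul_smul_comm,
      Derivation.map_smul]
  | x_mul j a ha =>
    rw [mul_assoc, symb_x_mul, symb_x_mul, ha, Derivation.leibniz, pderiv_X,
      Pi.single_eq_of_ne (by simp)]
    simp only [smul_eq_mul]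
    ring
  | d_mul j a ha =>
    rw [mul_assoc, symb_d_mul, symb_d_mul, ha]
    simp only [map_add, Derivation.leibniz, smul_eq_mul, pderiv_X, Pi.single_apply,
      pderiv_comm' (Sum.inl j : Fin n ⊕ Fin n) (Sum.inr i)]
    by_cases h : i = j
    · subst h; simp; ring
    · simp [h, Ne.symm h]; ring

theorem symb_mul_d (i : Fin n) (a : WeylAlgebra k n) :
    symb k n (a * d k i) = X (Sum.inr i) * symb k n a := by
  classical
  induction a using induction_left with
  | one =>
    have := symb_d_mul (k := k) i 1
    rw [mul_one] at this
    simp [this, symb_one]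
  | add a b ha hb => simp only [add_mul, map_add, ha, hb, mul_add]
  | smul c a ha => simp only [smul_mul_assoc, map_smul, ha, mul_smul_comm]
  | x_mul j a ha => rw [mul_assoc, symb_x_mul, symb_x_mul, ha]; ring
  | d_mul j a ha =>
    rw [mul_assoc, symb_d_mul, symb_d_mul, ha, Derivation.leibniz, pderiv_X,
      Pi.single_eq_of_ne (by simp)]
    simp only [smul_eq_mul]
    ring

theorem _root_.MvPolynomial.eq_C_of_pderiv_eq_zero [CharZero k] {σ : Type*} {p : MvPolynomial σ k}
    (hp : ∀ i, pderiv i p = 0) : p = C (coeff 0 p) := by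
  classical
  ext s
  rw [coeff_C]
  split_ifs with hs
  · rw [hs]
  · obtain ⟨i, hi⟩ := Finsupp.ne_iff.mp (Ne.symm hs)
    have h1 : Finsupp.single i 1 ≤ s := by
      rw [Finsupp.single_le_iff]
      exact Nat.one_le_iff_ne_zero.mpr hi
    have h2 := congrArg (coeff (s - Finsupp.single i 1)) (hp i)
    rw [coeff_pderiv, tsub_add_cancel_of_le h1, coeff_zero] at h2
    exact (mul_eq_zero.mp h2).resolve_right (Nat.cast_add_one_ne_zero _)

/-- The Weyl algebra is simple in characteristic zero: commutators with the generators
differentiate the symbol, so that a nonzero element of the kernel of minimal degree would be a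
scalar. -/
theorem algHom_injective [CharZero k] {B : Type*} [Ring B] [Nontrivial B] [Algebra k B]
    (φ : WeylAlgebra k n →ₐ[k] B) : Function.Injective φ := by
  rw [injective_iff_map_eq_zero]
  intro a ha
  obtain ⟨m, hm⟩ := exists_mem_V a
  induction m generalizing a with
  | zero => exact symb_injective (by rw [F_zero hm, map_zero])
  | succ m ih =>
    have hm' : symb k n a ∈ F k n (m + 1) := hm
    have h0 (j : Fin n ⊕ Fin n) : pderiv j (symb k n a) = 0 := by
      cases j with
      | inl i =>
        have e : symb k n (d k i * a - a * d k i) = pderiv (Sum.inl i) (symb k n a) := by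
          rw [map_sub, symb_d_mul, symb_mul_d, add_sub_cancel_left]
        have h1 : φ (d k i * a - a * d k i) = 0 := by
          rw [map_sub, map_mul, map_mul, ha, mul_zero, zero_mul, sub_zero]
        have h2 := F_pderiv (Sum.inl i) hm'
        rw [Nat.add_sub_cancel, ← e] at h2
        rw [← e, ih _ h1 h2, map_zero]
      | inr i =>
        have e : symb k n (a * x k i - x k i * a) = pderiv (Sum.inr i) (symb k n a) := by
          rw [map_sub, symb_x_mul, symb_mul_x, add_sub_cancel_left]
        have h1 : φ (a * x k i - x k i * a) = 0 := by
          rw [map_sub, map_mul, map_mul, ha, mul_zero, zero_mul, sub_zero]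
        have h2 := F_pderiv (Sum.inr i) hm'
        rw [Nat.add_sub_cancel, ← e] at h2
        rw [← e, ih _ h1 h2, map_zero]
    have hc := eq_C_of_pderiv_eq_zero h0
    set c := coeff 0 (symb k n a)
    have ha' : a = algebraMap k _ c := by
      apply symb_injective
      rw [hc, Algebra.algebraMap_eq_smul_one, map_smul, symb_one, smul_eq_C_mul, mul_one]
    rw [ha', AlgHom.commutes, map_eq_zero_iff _ (algebraMap k B).injective] at ha
    rw [ha', ha, map_zero]

theorem xPoly_injective : Function.Injective (xPoly k n) := by
  have h : ∀ p, symb k n (xPoly k n p) = rename Sum.inl p := by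
    intro p
    induction p using MvPolynomial.induction_on with
    | C c =>
      rw [← MvPolynomial.algebraMap_eq, AlgHom.commutes, AlgHom.commutes,
        Algebra.algebraMap_eq_smul_one, map_smul, symb_one, Algebra.algebraMap_eq_smul_one]
    | add p q hp hq => simp only [map_add, hp, hq]
    | mul_X p i hp =>
      rw [mul_comm, map_mul (xPoly k n), map_mul (rename Sum.inl), commEval_X, symb_x_mul, hp,
        rename_X]
  intro p q hpq
  refine rename_injective (R := k) (Sum.inl : Fin n → Fin n ⊕ Fin n)
    Sum.inl_injective ?_
  rw [← h, ← h, hpq]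

end WeylAlgebra

/-! ### Rational functions and vector fields in the Weyl field -/

namespace WeylField

variable {k : Type*} [Field k] {n : ℕ}

/-- The inclusion of the Weyl algebra. -/
noncomputable def ofWeyl (k : Type*) [Field k] (n : ℕ) : WeylAlgebra k n →ₐ[k] WeylField k n :=
  { OreLocalization.numeratorRingHom (S := (WeylAlgebra k n)⁰) with
    commutes' := fun _ => rfl }

theorem ofWeyl_apply (a : WeylAlgebra k n) :
    ofWeyl k n a = OreLocalization.numeratorHom a := rfl

theorem ofWeyl_injective : Function.Injective (ofWeyl k n) :=
  OreLocalization.numeratorHom_inj fun _ h => h.1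

theorem exists_mul_eq (z : WeylField k n) :
    ∃ s r : WeylAlgebra k n, s ≠ 0 ∧ ofWeyl k n s * z = ofWeyl k n r := by
  induction z using OreLocalization.ind with | _ r s
  exact ⟨s, r, nonZeroDivisors.coe_ne_zero s, by simp [ofWeyl_apply, OreLocalization.mul_cancel]⟩

/-- The extension of an embedding of `A_n(k)` into a skew field to `F_n(k)`. -/
noncomputable def lift {D : Type*} [DivisionRing D] [Algebra k D] (φ : WeylAlgebra k n →ₐ[k] D)
    (hφ : Function.Injective φ) : WeylField k n →ₐ[k] D :=
  { OreLocalization.universalHom (S := (WeylAlgebra k n)⁰) (φ : WeylAlgebra k n →+* D)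
      { toFun := fun s => Units.mk0 (φ s)
          ((map_ne_zero_iff φ hφ).mpr (nonZeroDivisors.coe_ne_zero s))
        map_one' := Units.ext (map_one φ)
        map_mul' := fun s t => Units.ext (map_mul φ (s : WeylAlgebra k n) t) }
      (fun _ => rfl) with
    commutes' := fun c => by
      refine (OreLocalization.universalHom_commutes _ _ _).trans ?_
      exact φ.commutes c }

theorem lift_ofWeyl {D : Type*} [DivisionRing D] [Algebra k D] (φ : WeylAlgebra k n →ₐ[k] D)
    (hφ : Function.Injective φ) (a : WeylAlgebra k n) : lift φ hφ (ofWeyl k n a) = φ a :=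
  OreLocalization.universalHom_commutes _ _ _

/-- The embedding of the rational functions in the `x_i`. -/
noncomputable def ofRat (k : Type*) [Field k] (n : ℕ) : RatFunField k n →ₐ[k] WeylField k n :=
  { OreLocalization.universalHom (S := (MvPolynomial (Fin n) k)⁰)
      (((ofWeyl k n).comp (WeylAlgebra.xPoly k n) :
        MvPolynomial (Fin n) k →ₐ[k] WeylField k n) : MvPolynomial (Fin n) k →+* WeylField k n)
      { toFun := fun s => Units.mk0 (ofWeyl k n (WeylAlgebra.xPoly k n s))
          ((map_ne_zero_iff _ ofWeyl_injective).mpr ((map_ne_zero_iff _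
            WeylAlgebra.xPoly_injective).mpr (nonZeroDivisors.coe_ne_zero s)))
        map_one' := Units.ext (by simp)
        map_mul' := fun s t => Units.ext (by simp) }
      (fun _ => rfl) with
    commutes' := fun c => by
      refine (OreLocalization.universalHom_commutes _ _ _).trans ?_
      exact ((ofWeyl k n).comp (WeylAlgebra.xPoly k n)).commutes c }

theorem ofRat_injective : Function.Injective (ofRat k n) :=
  RingHom.injective (ofRat k n : RatFunField k n →+* WeylField k n)

theorem ofRat_ofPoly (p : MvPolynomial (Fin n) k) :
    ofRat k n (RatFunField.ofPoly k n p) = ofWeyl k n (WeylAlgebra.xPoly k n p) :=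
  OreLocalization.universalHom_commutes _ _ _

/-- The partial derivative `∂_l` as an element of the Weyl field. -/
noncomputable abbrev del (k : Type*) [Field k] {n : ℕ} (l : Fin n) : WeylField k n :=
  ofWeyl k n (WeylAlgebra.d k l)

theorem del_mul_ofRat (l : Fin n) (a : RatFunField k n) :
    del k l * ofRat k n a =
      ofRat k n a * del k l + ofRat k n (RatFunField.partialDeriv k l a) := by
  have hpoly (p : MvPolynomial (Fin n) k) : del k l * ofRat k n (RatFunField.ofPoly k n p) =
      ofRat k n (RatFunField.ofPoly k n p) * del k l +
        ofRat k n (RatFunField.partialDeriv k l (RatFunField.ofPoly k n p)) := by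
    rw [RatFunField.partialDeriv_ofPoly, ofRat_ofPoly, ofRat_ofPoly, ← map_mul, ← map_mul,
      ← map_add, WeylAlgebra.d_mul_xPoly]
  obtain ⟨p, q, hq, rfl⟩ := RatFunField.exists_eq_div a
  set b := RatFunField.ofPoly k n q
  set a := RatFunField.ofPoly k n p / b
  have hb : b ≠ 0 := (map_ne_zero_iff _ RatFunField.ofPoly_injective).mpr hq
  have hab : RatFunField.ofPoly k n p = a * b := (div_mul_cancel₀ _ hb).symm
  have h1 := hpoly p
  rw [hab, Derivation.leibniz, map_add, smul_eq_mul, smul_eq_mul, map_mul, map_mul, map_mul,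
    mul_assoc _ _ (del k l)] at h1
  have h2 := hpoly q
  refine mul_right_cancel₀ ((map_ne_zero_iff _ ofRat_injective).mpr hb) ?_
  rw [mul_assoc, h1, add_mul, mul_assoc _ (del k l), h2, mul_add, add_assoc,
    ← map_mul _ b, ← map_mul _ _ b, mul_comm b]

/-- A vector field `E = ∑ E(x_l) ∂_l` as an element of the Weyl field. -/
noncomputable def ofDerivation (E : Derivation k (RatFunField k n) (RatFunField k n)) :
    WeylField k n :=
  ∑ l, ofRat k n (E (RatFunField.ofPoly k n (X l))) * del k l

theorem ofDerivation_mul_ofRat (E : Derivation k (RatFunField k n) (RatFunField k n))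
    (a : RatFunField k n) :
    ofDerivation E * ofRat k n a = ofRat k n a * ofDerivation E + ofRat k n (E a) := by
  rw [RatFunField.derivation_apply E a, map_sum, ofDerivation, Finset.sum_mul, Finset.mul_sum,
    ← Finset.sum_add_distrib]
  refine Finset.sum_congr rfl fun l _ => ?_
  rw [mul_assoc, del_mul_ofRat, mul_add, ← mul_assoc, ← mul_assoc, ← map_mul, ← map_mul,
    ← map_mul, mul_comm a]

theorem ofDerivation_zero :
    ofDerivation (0 : Derivation k (RatFunField k n) (RatFunField k n)) = 0 := by
  simp [ofDerivation]

/-- The embedding of vector fields respects commutators. -/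
theorem ofDerivation_lie (E E' : Derivation k (RatFunField k n) (RatFunField k n)) :
    ofDerivation ⁅E, E'⁆ = ofDerivation E * ofDerivation E' - ofDerivation E' * ofDerivation E := by
  have h (E E' : Derivation k (RatFunField k n) (RatFunField k n)) :
      ofDerivation E * ofDerivation E' =
      ∑ l', ∑ l, ofRat k n (E' (RatFunField.ofPoly k n (X l')) *
        E (RatFunField.ofPoly k n (X l))) * (del k l * del k l') +
      ∑ l, ofRat k n (E (E' (RatFunField.ofPoly k n (X l)))) * del k l := by
    conv_lhs => rw [ofDerivation.eq_def E', Finset.mul_sum]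
    rw [← Finset.sum_add_distrib]
    refine Finset.sum_congr rfl fun l' _ => ?_
    rw [← mul_assoc, ofDerivation_mul_ofRat, add_mul, ofDerivation, mul_assoc, Finset.sum_mul,
      Finset.mul_sum]
    simp only [map_mul, mul_assoc]
  rw [h E E', h E' E, Finset.sum_comm, add_sub_add_comm, ← Finset.sum_sub_distrib,
    ← Finset.sum_sub_distrib]
  rw [Finset.sum_eq_zero, zero_add]
  · simp only [ofDerivation, Derivation.commutator_apply, map_sub, sub_mul]
  · intro l _
    rw [← Finset.sum_sub_distrib]
    refine Finset.sum_eq_zero fun l' _ => ?_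
    rw [← map_mul (ofWeyl k n), ← map_mul (ofWeyl k n), WeylAlgebra.d_comm, mul_comm, sub_self]

end WeylField

end WeylField

/-! ### Linear substitutions -/

section LinearSubstitutions

open MvPolynomial

variable {k : Type*} [Field k] {n : ℕ}

/-- The linear substitution `x_j ↦ ∑ i, g i j • x_i`. -/
noncomputable def linearSubst (g : GL (Fin n) k) :
    MvPolynomial (Fin n) k →ₐ[k] MvPolynomial (Fin n) k :=
  aeval fun j => ∑ i, (g : Matrix (Fin n) (Fin n) k) i j • X i

theorem linearSubst_X (g : GL (Fin n) k) (j : Fin n) :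
    linearSubst g (X j) = ∑ i, (g : Matrix (Fin n) (Fin n) k) i j • X i := by
  simp [linearSubst]

theorem linearSubst_one : linearSubst (1 : GL (Fin n) k) = AlgHom.id k _ := by
  refine MvPolynomial.algHom_ext fun j => ?_
  simp [linearSubst_X, Matrix.one_apply]

theorem linearSubst_mul (g h : GL (Fin n) k) :
    linearSubst (g * h) = (linearSubst g).comp (linearSubst h) := by
  refine MvPolynomial.algHom_ext fun j => ?_
  simp only [linearSubst_X, AlgHom.comp_apply, map_sum, map_smul, Units.val_mul,
    Matrix.mul_apply, Finset.smul_sum, Finset.sum_smul, smul_smul]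
  rw [Finset.sum_comm]
  refine Finset.sum_congr rfl fun i _ => Finset.sum_congr rfl fun l _ => ?_
  rw [mul_comm]

/-- `GL_n(k)` acts on polynomials by linear substitutions. -/
noncomputable instance : MulSemiringAction (GL (Fin n) k) (MvPolynomial (Fin n) k) where
  smul g p := linearSubst g p
  one_smul p := congrArg (fun φ => φ p) linearSubst_one
  mul_smul g h p := congrArg (fun φ => φ p) (linearSubst_mul g h)
  smul_zero g := map_zero (linearSubst g)
  smul_add g := map_add (linearSubst g)
  smul_one g := map_one (linearSubst g)
  smul_mul g := map_mul (linearSubst g)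

theorem gl_smul_def (g : GL (Fin n) k) (p : MvPolynomial (Fin n) k) :
    g • p = linearSubst g p := rfl

instance : SMulCommClass (GL (Fin n) k) k (MvPolynomial (Fin n) k) :=
  ⟨fun g c p => map_smul (linearSubst g) c p⟩

/-- `GL_n(k)` acts on rational functions by linear substitutions. -/
noncomputable instance : MulSemiringAction (GL (Fin n) k) (RatFunField k n) :=
  IsFractionRing.mulSemiringAction (GL (Fin n) k) (MvPolynomial (Fin n) k) (RatFunField k n)

instance : SMulDistribClass (GL (Fin n) k) (MvPolynomial (Fin n) k) (RatFunField k n) :=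
  IsFractionRing.smulDistribClass (GL (Fin n) k) (MvPolynomial (Fin n) k) (RatFunField k n)

instance : SMulCommClass (GL (Fin n) k) k (RatFunField k n) :=
  IsFractionRing.smulCommClass (GL (Fin n) k) k (MvPolynomial (Fin n) k) k (RatFunField k n)

instance (W : Subgroup (GL (Fin n) k)) :
    SMulDistribClass W (MvPolynomial (Fin n) k) (RatFunField k n) :=
  ⟨fun g p a => smul_distrib_smul (g : GL (Fin n) k) p a⟩

theorem gl_smul_ofPoly (g : GL (Fin n) k) (p : MvPolynomial (Fin n) k) :
    g • RatFunField.ofPoly k n p = RatFunField.ofPoly k n (g • p) :=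
  (algebraMap.coe_smul' g p (RatFunField k n)).symm

theorem isHomogeneous_gl_smul (g : GL (Fin n) k) {p : MvPolynomial (Fin n) k} {d : ℕ}
    (hp : p.IsHomogeneous d) : (g • p).IsHomogeneous d := by
  rw [gl_smul_def, linearSubst]
  have := hp.aeval (fun j => ∑ i, (g : Matrix (Fin n) (Fin n) k) i j • X i) (n := 1) fun j =>
    IsHomogeneous.sum _ _ _ fun i _ => by
      rw [smul_eq_C_mul]
      exact isHomogeneous_C_mul_X _ _
  rwa [one_mul] at this

/-- A pseudo-reflection `g` moves all vectors by multiples of one vector, so that one linear form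
divides all `g p - p`. -/
theorem IsPseudoReflection.exists_dvd {g : GL (Fin n) k} (hg : IsPseudoReflection g) :
    ∃ l : MvPolynomial (Fin n) k, l ≠ 0 ∧ l.IsHomogeneous 1 ∧ ∀ p, l ∣ g • p - p := by
  classical
  set T := Matrix.toLin' (g : Matrix (Fin n) (Fin n) k) - LinearMap.id
  have h1 : Module.finrank k (LinearMap.range T) = 1 := by
    have h2 := T.finrank_range_add_finrank_ker
    have h3 := hg.2
    rw [Module.finrank_fin_fun] at h2
    change Module.finrank k (LinearMap.ker T) + 1 = n at h3
    omega
  obtain ⟨⟨v, hv⟩, hv0, hspan⟩ := finrank_eq_one_iff'.mp h1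
  have hv0' : v ≠ 0 := fun h => hv0 (Subtype.ext h)
  choose c hc using fun j => hspan ⟨T (Pi.single j 1), LinearMap.mem_range_self _ _⟩
  have hgij (i j : Fin n) : (g : Matrix (Fin n) (Fin n) k) i j =
      (if i = j then 1 else 0) + c j * v i := by
    have := congrFun (congrArg Subtype.val (hc j)) i
    simp [T, Pi.single_apply] at this
    rw [this]; ring
  refine ⟨∑ i, C (v i) * X i, ?_, IsHomogeneous.sum _ _ _ fun i _ => isHomogeneous_C_mul_X _ _, ?_⟩
  · intro h0
    refine hv0' (funext fun i => ?_)
    have := congrArg (coeff (Finsupp.single i 1)) h0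
    simpa [coeff_sum, coeff_C_mul, coeff_X, Finsupp.single_left_inj] using this
  · intro p
    induction p using MvPolynomial.induction_on with
    | C a =>
      rw [gl_smul_def, ← MvPolynomial.algebraMap_eq, AlgHom.commutes, sub_self]
      exact dvd_zero _
    | add p q hp hq =>
      rw [smul_add, add_sub_add_comm]
      exact dvd_add hp hq
    | mul_X p j hp =>
      have hX : g • (X j : MvPolynomial (Fin n) k) - X j = (∑ i, C (v i) * X i) * C (c j) := by
        rw [gl_smul_def, linearSubst_X]
        simp only [hgij, add_smul, Finset.sum_add_distrib, ite_smul, one_smul, zero_smul,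
          Finset.sum_ite_eq', Finset.mem_univ, if_true, add_sub_cancel_left, Finset.sum_mul]
        refine Finset.sum_congr rfl fun i _ => ?_
        rw [smul_eq_C_mul, map_mul]; ring
      have e : g • (p * X j) - p * X j = (g • p - p) * (g • X j) + p * (g • X j - X j) := by
        rw [MulSemiringAction.smul_mul]; ring
      rw [e, hX]
      exact dvd_add (Dvd.dvd.mul_right hp _) (Dvd.dvd.mul_left (Dvd.intro _ rfl) _)

theorem IsPseudoReflectionGroup.isReflectionAction {W : Subgroup (GL (Fin n) k)}
    (hW : IsPseudoReflectionGroup W) : IsReflectionAction k n W where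
  homog g _ _ hp := isHomogeneous_gl_smul (g : GL (Fin n) k) hp
  closure_eq_top := by
    set T := {s : W | ∃ l : MvPolynomial (Fin n) k,
      l ≠ 0 ∧ l.IsHomogeneous 1 ∧ ∀ p, l ∣ s • p - p}
    have h : W ≤ (Subgroup.closure T).map W.subtype := by
      conv_lhs => rw [← hW.2]
      rw [Subgroup.closure_le]
      rintro g ⟨hgW, hg⟩
      exact ⟨⟨g, hgW⟩, Subgroup.subset_closure hg.exists_dvd, rfl⟩
    rw [eq_top_iff]
    rintro ⟨w, hw⟩ _
    obtain ⟨w', hw', rfl⟩ := h hw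
    exact hw'

namespace WeylField

theorem linearAction_ofWeyl (g : GL (Fin n) k) (a : WeylAlgebra k n) :
    linearAction k n g (ofWeyl k n a) = ofWeyl k n (WeylAlgebra.linearEnd g a) :=
  extend_numerator _ a

theorem linearAction_ofRat (g : GL (Fin n) k) (a : RatFunField k n) :
    linearAction k n g (ofRat k n a) = ofRat k n (g • a) := by
  have hpoly (p : MvPolynomial (Fin n) k) :
      linearAction k n g (ofRat k n (RatFunField.ofPoly k n p)) =
        ofRat k n (g • RatFunField.ofPoly k n p) := by
    rw [gl_smul_ofPoly, ofRat_ofPoly, ofRat_ofPoly, linearAction_ofWeyl, gl_smul_def]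
    congr 1
    have : (WeylAlgebra.linearEnd g).comp (WeylAlgebra.xPoly k n) =
        (WeylAlgebra.xPoly k n).comp (linearSubst g) := by
      refine MvPolynomial.algHom_ext fun j => ?_
      simp only [AlgHom.comp_apply, WeylAlgebra.commEval_X, WeylAlgebra.linearEnd_x,
        linearSubst_X, map_sum, map_smul]
    exact congrArg (fun φ => φ p) this
  obtain ⟨p, q, _, rfl⟩ := RatFunField.exists_eq_div a
  rw [smul_div₀', map_div₀, map_div₀, map_div₀, hpoly, hpoly]

theorem linearAction_ofDerivation (g : GL (Fin n) k)
    (E : Derivation k (RatFunField k n) (RatFunField k n)) :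
    linearAction k n g (ofDerivation E) =
      ofDerivation (E.conj (MulSemiringAction.toAlgEquiv k (RatFunField k n) g)) := by
  have hE (j : Fin n) : E.conj (MulSemiringAction.toAlgEquiv k (RatFunField k n) g)
      (RatFunField.ofPoly k n (X j)) = ∑ l, ((g⁻¹ : GL (Fin n) k) : Matrix (Fin n) (Fin n) k) l j •
        g • E (RatFunField.ofPoly k n (X l)) := by
    have h1 : (MulSemiringAction.toAlgEquiv k (RatFunField k n) g).symm
        (RatFunField.ofPoly k n (X j)) = RatFunField.ofPoly k n (g⁻¹ • X j) :=
      gl_smul_ofPoly g⁻¹ _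
    rw [Derivation.conj_apply, h1, gl_smul_def, linearSubst_X]
    simp only [map_sum, map_smul, MulSemiringAction.toAlgEquiv_apply, Derivation.map_smul]
  simp only [ofDerivation, hE, map_sum, map_mul, linearAction_ofRat, linearAction_ofWeyl, del,
    WeylAlgebra.linearEnd_d, Finset.mul_sum, Finset.sum_mul, map_smul, mul_smul_comm,
    smul_mul_assoc]
  rw [Finset.sum_comm]

end WeylField

end LinearSubstitutions

/-! ### The skew field of invariants -/

section Invariants

open MvPolynomial

variable {k : Type*} [Field k] {n : ℕ}

namespace WeylField

/-- If a skew subfield `L` of `F_n(k)` contains the invariant rational functions and a basis of the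
vector fields with dual coordinates `f`, then `F_n(k)` is spanned by the rational functions over
`L`: their span is finite-dimensional and stable under right multiplication by the Weyl algebra,
hence also by the inverses of its elements. -/
theorem span_range_ofRat_eq_top (W : Subgroup (GL (Fin n) k)) [Finite W]
    (L : Subfield (WeylField k n))
    (hL : ∀ a : RatFunField k n, (∀ g : W, g • a = a) → ofRat k n a ∈ L)
    {f : Fin n → MvPolynomial (Fin n) k}
    {D : Fin n → Derivation k (RatFunField k n) (RatFunField k n)}
    (hD : ∀ i j, D i (RatFunField.ofPoly k n (f j)) = if i = j then 1 else 0)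
    (hf : ∀ E : Derivation k (RatFunField k n) (RatFunField k n),
      (∀ i, E (RatFunField.ofPoly k n (f i)) = 0) → E = 0)
    (hDL : ∀ i, ofDerivation (D i) ∈ L) :
    Submodule.span L (Set.range (ofRat k n)) = ⊤ := by
  classical
  have smul_def (l : L) (z : WeylField k n) : l • z = (l : WeylField k n) * z := rfl
  set M := Submodule.span L (Set.range (ofRat k n))
  have hfin : Module.Finite L M := by
    obtain ⟨s, hs⟩ := Module.Finite.fg_top
      (R := FixedPoints.subfield W (RatFunField k n)) (M := RatFunField k n)
    have hle : M ≤ Submodule.span L ((s.image (ofRat k n) : Finset (WeylField k n)) :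
        Set (WeylField k n)) := by
      rw [Submodule.span_le]
      rintro _ ⟨a, rfl⟩
      have ha : a ∈ Submodule.span (FixedPoints.subfield W (RatFunField k n))
          (s : Set (RatFunField k n)) := by rw [hs]; trivial
      rw [SetLike.mem_coe]
      induction ha using Submodule.span_induction with
      | mem x hx => exact Submodule.subset_span (Finset.mem_image_of_mem _ hx)
      | zero => rw [map_zero]; exact zero_mem _
      | add x y _ _ hx hy => rw [map_add]; exact add_mem hx hy
      | smul c x _ hx =>
        rw [Subfield.smul_def, smul_eq_mul, map_mul]
        exact Submodule.smul_mem _ (⟨ofRat k n c, hL c c.2⟩ : L) hx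
    exact Submodule.finiteDimensional_of_le hle
  -- The subring of those elements whose right multiplication preserves `M`.
  let T : Subring (WeylField k n) :=
    { carrier := {t | ∀ z ∈ M, z * t ∈ M}
      mul_mem' := fun {a b} ha hb z hz => by
        rw [← mul_assoc]; exact hb _ (ha _ hz)
      one_mem' := fun z hz => by rwa [mul_one]
      add_mem' := fun {a b} ha hb z hz => by
        rw [mul_add]; exact add_mem (ha _ hz) (hb _ hz)
      zero_mem' := fun z _ => by rw [mul_zero]; exact zero_mem _
      neg_mem' := fun {a} ha z hz => by rw [mul_neg]; exact neg_mem (ha _ hz) }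
  have hT {t : WeylField k n} (h : ∀ a, ofRat k n a * t ∈ M) : t ∈ T := by
    intro z hz
    induction hz using Submodule.span_induction with
    | mem x hx => obtain ⟨a, rfl⟩ := hx; exact h a
    | zero => rw [zero_mul]; exact zero_mem _
    | add x y _ _ hx hy => rw [add_mul]; exact add_mem hx hy
    | smul c x _ hx =>
      rw [smul_def, mul_assoc]
      exact Submodule.smul_mem _ c hx
  have hTrat (a : RatFunField k n) : ofRat k n a ∈ T :=
    hT fun b => Submodule.subset_span ⟨b * a, map_mul _ _ _⟩
  have hTD (i : Fin n) : ofDerivation (D i) ∈ T := hT fun a => by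
    rw [eq_sub_of_add_eq (ofDerivation_mul_ofRat (D i) a).symm]
    exact sub_mem (Submodule.smul_mem M (⟨_, hDL i⟩ : L) (Submodule.subset_span ⟨a, rfl⟩))
      (Submodule.subset_span ⟨_, rfl⟩)
  have hTdel (l : Fin n) : del k l ∈ T := by
    have h1 : RatFunField.partialDeriv k l = ∑ i, RatFunField.partialDeriv k l
        (RatFunField.ofPoly k n (f i)) • D i := by
      rw [← sub_eq_zero]
      refine hf _ fun j => ?_
      rw [Derivation.sub_apply, Derivation.sum_smul_apply]
      simp only [hD, mul_ite, mul_one, mul_zero, Finset.sum_ite_eq', Finset.mem_univ, if_true,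
        sub_self]
    have h2 : del k l = ofDerivation (RatFunField.partialDeriv k l) := by
      simp only [ofDerivation, RatFunField.partialDeriv_ofPoly, pderiv_X, Pi.single_apply,
        apply_ite (RatFunField.ofPoly k n), apply_ite (ofRat k n), map_one, map_zero, ite_mul,
        one_mul, zero_mul, Finset.sum_ite_eq', Finset.mem_univ, if_true]
    have h3 : ofDerivation (RatFunField.partialDeriv k l) =
        ∑ i, ofRat k n (RatFunField.partialDeriv k l (RatFunField.ofPoly k n (f i))) *
          ofDerivation (D i) := by
      conv_lhs => rw [h1]
      simp only [ofDerivation, Derivation.sum_smul_apply, map_sum, map_mul, Finset.sum_mul,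
        Finset.mul_sum, mul_assoc]
      rw [Finset.sum_comm]
    rw [h2, h3]
    exact sum_mem fun i _ => mul_mem (hTrat _) (hTD i)
  have hTweyl (a : WeylAlgebra k n) : ofWeyl k n a ∈ T := by
    induction a using WeylAlgebra.induction_left with
    | one => rw [map_one]; exact one_mem _
    | add a b ha hb => rw [map_add]; exact add_mem ha hb
    | smul c a ha =>
      rw [map_smul, Algebra.smul_def, ← AlgHom.commutes (ofRat k n)]
      exact mul_mem (hTrat _) ha
    | x_mul i a ha =>
      have : ofWeyl k n (WeylAlgebra.x k i) = ofRat k n (RatFunField.ofPoly k n (X i)) := by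
        rw [ofRat_ofPoly, WeylAlgebra.commEval_X]
      rw [map_mul, this]
      exact mul_mem (hTrat _) ha
    | d_mul i a ha => rw [map_mul]; exact mul_mem (hTdel i) ha
  have hTinv {t : WeylField k n} (ht : t ∈ T) (ht0 : t ≠ 0) : t⁻¹ ∈ T := by
    -- Right multiplication by `t` is injective on the finite-dimensional `M`, so it is onto.
    let ρ : M →ₗ[L] M :=
      { toFun := fun z => ⟨z * t, ht z z.2⟩
        map_add' := fun z z' => Subtype.ext (add_mul _ _ _)
        map_smul' := fun l z => Subtype.ext (mul_assoc (l : WeylField k n) z t) }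
    have hρ : Function.Injective ρ := fun z z' h =>
      Subtype.ext (mul_right_cancel₀ ht0 (congrArg Subtype.val h))
    intro z hz
    obtain ⟨z', hz'⟩ := LinearMap.injective_iff_surjective.mp hρ ⟨z, hz⟩
    have : (z' : WeylField k n) * t = z := congrArg Subtype.val hz'
    rw [← this, mul_assoc, mul_inv_cancel₀ ht0, mul_one]
    exact z'.2
  rw [eq_top_iff]
  intro z _
  obtain ⟨s, r, hs, hz⟩ := exists_mul_eq z
  have hs' : ofWeyl k n s ≠ 0 := (map_ne_zero_iff _ ofWeyl_injective).mpr hs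
  have hz' : z = 1 * ((ofWeyl k n s)⁻¹ * ofWeyl k n r) := by
    rw [one_mul, ← hz, inv_mul_cancel_left₀ hs']
  rw [hz']
  exact mul_mem (hTinv (hTweyl s) hs') (hTweyl r) 1
    (Submodule.subset_span ⟨1, map_one _⟩)

/-- An invariant equals its average over `W`, and the average of a combination of rational functions
with coefficients in a skew field `L` of invariants is the combination of their averages. -/
theorem mem_of_mem_invariants [CharZero k] (W : Subgroup (GL (Fin n) k)) [Finite W]
    (L : Subfield (WeylField k n)) (hLW : ∀ z ∈ L, z ∈ invariants W)
    (hL : ∀ a : RatFunField k n, (∀ g : W, g • a = a) → ofRat k n a ∈ L)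
    (hspan : Submodule.span L (Set.range (ofRat k n)) = ⊤)
    {z : WeylField k n} (hz : z ∈ invariants W) : z ∈ L := by
  have := Fintype.ofFinite W
  have havg (z : WeylField k n) (hz : z ∈ Submodule.span L (Set.range (ofRat k n))) :
      ∑ w : W, linearAction k n w z ∈ L := by
    induction hz using Submodule.span_induction with
    | mem x hx =>
      obtain ⟨a, rfl⟩ := hx
      simp only [linearAction_ofRat, ← map_sum]
      refine hL _ fun g => ?_
      rw [Finset.smul_sum]
      refine Fintype.sum_equiv (Equiv.mulLeft g) _ _ fun w => ?_
      exact (mul_smul (g : GL (Fin n) k) (w : GL (Fin n) k) a).symm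
    | zero => simp only [map_zero, Finset.sum_const_zero]; exact zero_mem _
    | add x y _ _ hx hy =>
      simp only [map_add, Finset.sum_add_distrib]
      exact add_mem hx hy
    | smul l x _ hx =>
      have h (w : W) : linearAction k n w (l • x) = (l : WeylField k n) * linearAction k n w x := by
        change linearAction k n w ((l : WeylField k n) * x) = _
        rw [map_mul, hLW l l.2 w w.2]
      simp only [h, ← Finset.mul_sum]
      exact mul_mem l.2 hx
  have h1 := havg z (by rw [hspan]; trivial)
  simp only [fun w : W => hz w w.2, Finset.sum_const, Finset.card_univ, nsmul_eq_mul] at h1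
  have h0 : (Fintype.card W : WeylField k n) ≠ 0 := by
    rw [← map_natCast (algebraMap k (WeylField k n)), map_ne_zero_iff _
      (algebraMap k (WeylField k n)).injective]
    exact Nat.cast_ne_zero.mpr Fintype.card_ne_zero
  have h2 := mul_mem (inv_mem (natCast_mem L (Fintype.card W))) h1
  rwa [inv_mul_cancel_left₀ h0] at h2

end WeylField

end Invariants

theorem mainTheorem4 {k : Type*} [Field k] [CharZero k] (n : ℕ) (W : Subgroup (GL (Fin n) k))
    (hW : IsPseudoReflectionGroup W) :
    Nonempty (WeylField.invariants W ≃ₐ[k] WeylField k n) := by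
  classical
  have : Finite W := hW.1
  have := Fintype.ofFinite W
  obtain ⟨f, D, hfW, hD, hf, hrat⟩ := hW.isReflectionAction.exists_coordinates
  let fF : Fin n → WeylField k n := fun i => WeylField.ofRat k n (RatFunField.ofPoly k n (f i))
  let DF : Fin n → WeylField k n := fun i => WeylField.ofDerivation (D i)
  have hone (i j : Fin n) : D i (RatFunField.ofPoly k n (f j)) =
      algebraMap k _ (if i = j then 1 else 0) := by
    rw [hD]; split_ifs <;> simp
  have hlie (i j : Fin n) : ⁅D i, D j⁆ = 0 := hf _ fun l => by
    rw [Derivation.commutator_apply, hone, hone, Derivation.map_algebraMap,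
      Derivation.map_algebraMap, sub_self]
  let φ₀ : WeylAlgebra k n →ₐ[k] WeylField k n := WeylAlgebra.lift fF DF
    (fun i j => by simp only [fF, ← map_mul, mul_comm])
    (fun i j => by
      rw [← sub_eq_zero, ← WeylField.ofDerivation_lie, hlie, WeylField.ofDerivation_zero])
    (fun i j => by
      rw [sub_eq_iff_eq_add', WeylField.ofDerivation_mul_ofRat, hD, apply_ite (WeylField.ofRat k n),
        map_one, map_zero])
  let φ := WeylField.lift φ₀ (WeylAlgebra.algHom_injective φ₀)
  have hφx (i : Fin n) : φ (WeylField.ofWeyl k n (WeylAlgebra.x k i)) = fF i := by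
    rw [WeylField.lift_ofWeyl, WeylAlgebra.lift_x]
  have hφd (i : Fin n) : φ (WeylField.ofWeyl k n (WeylAlgebra.d k i)) = DF i := by
    rw [WeylField.lift_ofWeyl, WeylAlgebra.lift_d]
  -- Both sides are dual to the invariants `f j`.
  have hconj (g : GL (Fin n) k) (hg : g ∈ W) (i : Fin n) :
      (D i).conj (MulSemiringAction.toAlgEquiv k (RatFunField k n) g) = D i := by
    rw [← sub_eq_zero]
    refine hf _ fun j => ?_
    have h1 : (MulSemiringAction.toAlgEquiv k (RatFunField k n) g).symm
        (RatFunField.ofPoly k n (f j)) = RatFunField.ofPoly k n (f j) := by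
      rw [AlgEquiv.symm_apply_eq, MulSemiringAction.toAlgEquiv_apply, gl_smul_ofPoly]
      exact congrArg _ (hfW ⟨g, hg⟩ j).symm
    rw [Derivation.sub_apply, Derivation.conj_apply, h1, hone, AlgEquiv.commutes, sub_self]
  have hinv (z : WeylField k n) : φ z ∈ WeylField.invariants W := by
    intro g hg
    have h : ((WeylField.linearAction k n g).toAlgHom.comp φ) = φ := by
      refine WeylField.algHom_ext fun a => ?_
      have h' : ((WeylField.linearAction k n g).toAlgHom.comp φ).comp (WeylField.ofWeyl k n) =
          φ.comp (WeylField.ofWeyl k n) := by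
        refine WeylAlgebra.algHom_ext (fun i => ?_) (fun i => ?_)
        · change WeylField.linearAction k n g (φ (WeylField.ofWeyl k n (WeylAlgebra.x k i))) =
            φ (WeylField.ofWeyl k n (WeylAlgebra.x k i))
          rw [hφx, WeylField.linearAction_ofRat, gl_smul_ofPoly]
          exact congrArg (fun p => WeylField.ofRat k n (RatFunField.ofPoly k n p)) (hfW ⟨g, hg⟩ i)
        · change WeylField.linearAction k n g (φ (WeylField.ofWeyl k n (WeylAlgebra.d k i))) =
            φ (WeylField.ofWeyl k n (WeylAlgebra.d k i))
          rw [hφd, WeylField.linearAction_ofDerivation, hconj g hg]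
      exact congrArg (fun ψ => ψ a) h'
    exact congrArg (fun ψ => ψ z) h
  let L : Subfield (WeylField k n) := (φ : WeylField k n →+* WeylField k n).fieldRange
  have hpolyL (p : MvPolynomial (Fin n) k) (hp : p ∈ Algebra.adjoin k (Set.range f)) :
      WeylField.ofRat k n (RatFunField.ofPoly k n p) ∈ L := by
    induction hp using Algebra.adjoin_induction with
    | mem x hx => obtain ⟨i, rfl⟩ := hx; exact ⟨_, hφx i⟩
    | algebraMap c =>
      rw [AlgHom.commutes, AlgHom.commutes]
      exact ⟨algebraMap k _ c, φ.commutes c⟩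
    | add x y _ _ hx hy => rw [map_add, map_add]; exact add_mem hx hy
    | mul x y _ _ hx hy => rw [map_mul, map_mul]; exact mul_mem hx hy
  have hL (a : RatFunField k n) (ha : ∀ g : W, g • a = a) : WeylField.ofRat k n a ∈ L := by
    obtain ⟨p, hp, q, hq, rfl⟩ := hrat a ha
    rw [map_div₀]
    exact div_mem (hpolyL p hp) (hpolyL q hq)
  have hLW : ∀ z ∈ L, z ∈ WeylField.invariants W := by
    rintro _ ⟨z, rfl⟩
    exact hinv z
  have hspan := WeylField.span_range_ofRat_eq_top W L hL hD hf fun i => ⟨_, hφd i⟩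
  have hrange : φ.range = WeylField.invariants W := by
    ext z
    refine ⟨?_, fun hz => ?_⟩
    · rintro ⟨z, rfl⟩
      exact hinv z
    · exact WeylField.mem_of_mem_invariants W L hLW hL hspan hz
  have hφ : Function.Injective φ := RingHom.injective (φ : WeylField k n →+* WeylField k n)
  exact ⟨(Subalgebra.equivOfEq _ _ hrange.symm).trans (AlgEquiv.ofInjective φ hφ).symm⟩
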